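/- Let $d\ge 8$ be an integer and let $o$ be the origin of $\mathbb{E}^d$. Let $\sigma_d$ be Rogers' bound, that is, the proportion of the volume of a regular $d$-dimensional simplex of edge length $2$ in $\mathbb{E}^d$ that is covered by the $d+1$ closed unit balls centred at its vertices. Let $\mathrm{conv}\{o,w_1,\dots,w_d\}$ be an orthoscheme in $\mathbb{E}^d$ (i.e. $w_i$ is orthogonal to $w_j-w_i$ for all $1\le i<j\le d$) with $\|w_i\|=\sqrt{\frac{2i}{i+1}}$ for $1\le i\le d$. In the plane of the triangle $w_{d-2}w_{d-1}w_d$ let $w_{d+1}$ be the point with $\|w_{d+1}-w_{d-2}\|=\|w_d-w_{d-2}\|$ and $\angle w_dw_{d-2}w_{d+1}=\frac{\pi}{4}-\angle w_{d-1}w_{d-2}w_d$ that is separated from $w_{d-1}$ by the line $w_{d-2}w_d$. Let $D$ be the union of the triangle $w_{d-2}w_{d-1}w_d$ and the circular sector with centre $w_{d-2}$ over the circular arc from $w_d$ to $w_{d+1}$ of central angle $\angle w_dw_{d-2}w_{d+1}$. Put $$W=\mathrm{conv}\left(\{o,w_1,\dots,w_{d-3}\}\cup D\right),\qquad \widehat\sigma_d=\frac{\mathrm{Vol}_d(W\cap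 B)}{\mathrm{Vol}_d(W)},$$ where $B$ is the closed unit ball centred at $o$. (These quantities do not depend on the choice of the simplex or of the orthoscheme.) Then $\widehat\sigma_d<\sigma_d$ for all $d\ge 8$. -/

import Mathlib

open MeasureTheory

noncomputable section

namespace SpherePacking

/-- Euclidean `d`-space. -/
abbrev E (d : ℕ) : Type := EuclideanSpace ℝ (Fin d)

/-- The points `p 0, …, p d` are the vertices of a regular `d`-dimensional simplex of edge
length `2`. -/
def IsRegularSimplexOfEdgeTwo {d : ℕ} (p : Fin (d + 1) → E d) : Prop :=
  ∀ i j : Fin (d + 1), i ≠ j → dist (p i) (p j) = 2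

/-- The proportion of the simplex with vertices `p 0, …, p d` that is covered by the unit balls
centred at its vertices. For a regular simplex of edge length `2` this is Rogers' bound `σ_d`. -/
def simplexDensity {d : ℕ} (p : Fin (d + 1) → E d) : ℝ :=
  volume.real (convexHull ℝ (Set.range p) ∩ ⋃ i, Metric.closedBall (p i) 1) /
    volume.real (convexHull ℝ (Set.range p))

/-- The circular sector with centre `c` and radius `‖a - c‖`, lying in the plane through `c`, `a`,
`b` and sitting over the arc from `a` towards `b` (for `0 < ∠ a c b < π`). -/
def circularSector {d : ℕ} (c a b : E d) : Set (E d) :=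
  {x | dist x c ≤ dist a c ∧
    ∃ s t : ℝ, 0 ≤ s ∧ 0 ≤ t ∧ x = c + s • (a - c) + t • (b - c)}

/-- The points `w 1, …, w (d + 1)` of Euclidean `d`-space are in the position that defines the
wedge `W`. Only the values of `w` at the indices `1, …, d + 1` matter. -/
structure IsWedgeFrame {d : ℕ} (w : ℕ → E d) : Prop where
  /-- `‖w i‖ = √(2 i / (i + 1))` for `1 ≤ i ≤ d`. -/
  norm_eq : ∀ i : ℕ, 1 ≤ i → i ≤ d → ‖w i‖ = Real.sqrt (2 * (i : ℝ) / ((i : ℝ) + 1))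
  /-- `conv {o, w 1, …, w d}` is an orthoscheme: `w i` is orthogonal to all `w j - w i`, `i < j ≤ d`
  (with the prescribed norms, `o, w 1, …, w d` are then affinely independent). -/
  orthogonal : ∀ i j : ℕ, 1 ≤ i → i < j → j ≤ d → inner ℝ (w i) (w j - w i) = 0
  /-- `w (d + 1)` lies in the plane of the triangle `w (d - 2)`, `w (d - 1)`, `w d`. -/
  mem_plane : w (d + 1) ∈ affineSpan ℝ ({w (d - 2), w (d - 1), w d} : Set (E d))
  /-- `w (d + 1)` and `w d` are at the same distance from `w (d - 2)`. -/
  dist_eq : dist (w (d + 1)) (w (d - 2)) = dist (w d) (w (d - 2))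
  /-- The central angle of the sector. -/
  angle_eq : EuclideanGeometry.angle (w d) (w (d - 2)) (w (d + 1)) =
    Real.pi / 4 - EuclideanGeometry.angle (w (d - 1)) (w (d - 2)) (w d)
  /-- The line through `w (d - 2)` and `w d` separates `w (d - 1)` from `w (d + 1)`. -/
  opposite : (affineSpan ℝ ({w (d - 2), w d} : Set (E d))).SOppSide (w (d - 1)) (w (d + 1))

/-- The two-dimensional convex domain `D`: the triangle `w (d - 2)`, `w (d - 1)`, `w d` together
with the circular sector with centre `w (d - 2)` over the arc from `w d` to `w (d + 1)`. -/
def wedgeDomain {d : ℕ} (w : ℕ → E d) : Set (E d) :=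
  convexHull ℝ ({w (d - 2), w (d - 1), w d} : Set (E d)) ∪
    circularSector (w (d - 2)) (w d) (w (d + 1))

/-- The wedge `W = conv ({o, w 1, …, w (d - 3)} ∪ D)`. -/
def wedge {d : ℕ} (w : ℕ → E d) : Set (E d) :=
  convexHull ℝ (({0} ∪ w '' Set.Icc 1 (d - 3)) ∪ wedgeDomain w)

/-- The density of the unit ball centred at the origin in the wedge `W`. -/
def wedgeDensity {d : ℕ} (w : ℕ → E d) : ℝ :=
  volume.real (wedge w ∩ Metric.closedBall 0 1) / volume.real (wedge w)

end SpherePacking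

end

noncomputable section

namespace SpherePacking

open Module

/-! ### Regular simplices and their chambers -/

section

variable {d : ℕ}

/-! The symmetries of a regular simplex cut it into `(d + 1)!` congruent chambers, in each of which
one fixed vertex is nearest. So Rogers' bound is the density of the unit ball in a single chamber,
and that chamber is the orthoscheme `conv {o, w 1, …, w d}`
(`IsRogersOrthoscheme.simplexDensity_eq`).

The wedge is this orthoscheme (the core) together with a rim lying over the circular sector. Let `C
= conv {o, w 1, …, w (d - 3)}`, `c = w (d - 2)`, and let `P` be the plane through the origin
parallel to `D`, which is orthogonal to `C` and `c`. Core and rim are joins of `C` with `c +`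
triangle and `c +` sector. Over a point `y` of `conv (C ∪ {c})` their slices parallel to `P` are the
triangle and the sector, dilated by the same height `t(y)`. The ball meets the slice of the rim in a
sector again, dilated by the smaller height `min (t(y)) (√(1 - ‖y‖²) / ‖a‖)`, where `a = w d - c`
and `‖a‖` is the radius of the sector.

Using these smaller heights with the triangle gives a subset `cutCore` of the core. In each volume
the area of the planar shape factors out of the integral over `y`, so `cutCore` fills the same
fraction of the core as the ball does of the rim (`volume_core_mul`). The triangle lies in the disc
of radius `‖a‖`, hence `cutCore` lies in the ball, and its corner `e = w (d - 1) - c` is strictly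
inside the disc, so the ball covers strictly more of the core (`volume_cutCore_lt`). The rim thus
has smaller density than the core, and so does their union (`density_lt`). -/

theorem IsRegularSimplexOfEdgeTwo.norm_sq_sum_smul {p : Fin (d + 1) → E d}
    (hp : IsRegularSimplexOfEdgeTwo p) {a : Fin (d + 1) → ℝ} (ha : ∑ i, a i = 0) :
    ‖∑ i, a i • p i‖ ^ 2 = 2 * ∑ i, a i ^ 2 := by
  have h := EuclideanGeometry.inner_weightedVSub p ha p ha
  rw [Finset.univ.weightedVSub_eq_linear_combination ha, real_inner_self_eq_norm_sq] at h
  rw [h]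
  -- All off-diagonal squared distances are 4, so extending them to the diagonal gives `4 (∑ a)² =
  -- 0` and leaves only the diagonal correction.
  have h2 : ∀ i j, a i * a j * (dist (p i) (p j) * dist (p i) (p j))
      = 4 * (a i * a j) - if i = j then 4 * a i ^ 2 else 0 := by
    intro i j
    split_ifs with hij
    · subst hij; simp; ring
    · rw [hp i j hij]; ring
  simp_rw [h2, Finset.sum_sub_distrib, Finset.sum_ite_eq, Finset.mem_univ, if_true,
    ← Finset.mul_sum, ha]
  simp
  ring

theorem IsRegularSimplexOfEdgeTwo.affineIndependent {p : Fin (d + 1) → E d}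
    (hp : IsRegularSimplexOfEdgeTwo p) : AffineIndependent ℝ p := by
  rw [affineIndependent_iff_of_fintype]
  intro a ha h i
  rw [Finset.univ.weightedVSub_eq_linear_combination ha] at h
  have h2 := hp.norm_sq_sum_smul ha
  rw [h] at h2
  have h3 : ∑ i, a i ^ 2 = 0 := by simpa using h2.symm
  have h4 := (Finset.sum_eq_zero_iff_of_nonneg (fun i _ => sq_nonneg (a i))).1 h3 i
    (Finset.mem_univ i)
  simpa using h4

/-- A regular simplex of full dimension, as an affine basis. -/
def IsRegularSimplexOfEdgeTwo.affineBasis {p : Fin (d + 1) → E d}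
    (hp : IsRegularSimplexOfEdgeTwo p) : AffineBasis (Fin (d + 1)) ℝ (E d) :=
  ⟨p, hp.affineIndependent, by
    rw [hp.affineIndependent.affineSpan_eq_top_iff_card_eq_finrank_add_one]; simp⟩

@[simp] theorem IsRegularSimplexOfEdgeTwo.coe_affineBasis {p : Fin (d + 1) → E d}
    (hp : IsRegularSimplexOfEdgeTwo p) : ⇑hp.affineBasis = p := rfl

/-- The map that keeps barycentric coordinates is an isometry, because by `norm_sq_sum_smul` a
distance depends only on the differences of these coordinates. -/
theorem IsRegularSimplexOfEdgeTwo.exists_isometry {p q : Fin (d + 1) → E d}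
    (hp : IsRegularSimplexOfEdgeTwo p) (hq : IsRegularSimplexOfEdgeTwo q) :
    ∃ g : E d ≃ᵃⁱ[ℝ] E d, ∀ i, g (p i) = q i := by
  let b := hp.affineBasis
  let f : E d →ᵃ[ℝ] E d :=
    ∑ i, (LinearMap.toSpanSingleton ℝ (E d) (q i)).toAffineMap.comp (b.coord i)
  have hf : ∀ x, f x = ∑ i, b.coord i x • q i := by
    intro x
    have : f x = ∑ i, ((LinearMap.toSpanSingleton ℝ (E d) (q i)).toAffineMap.comp (b.coord i)) x :=
      map_sum (⟨⟨fun g : E d →ᵃ[ℝ] E d => g x, rfl⟩, fun _ _ => rfl⟩ :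
        (E d →ᵃ[ℝ] E d) →+ E d) _ _
    rw [this]
    rfl
  have hx : ∀ x, x = ∑ i, b.coord i x • p i := by
    intro x
    have := b.linear_combination_coord_eq_self x
    exact this.symm
  have hdist : ∀ x y, dist (f x) (f y) = dist x y := by
    intro x y
    have h0 : ∑ i, (b.coord i x - b.coord i y) = 0 := by
      rw [Finset.sum_sub_distrib, b.sum_coord_apply_eq_one, b.sum_coord_apply_eq_one, sub_self]
    have h1 : f x - f y = ∑ i, (b.coord i x - b.coord i y) • q i := by
      simp_rw [hf, sub_smul, Finset.sum_sub_distrib]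
    have h2 : x - y = ∑ i, (b.coord i x - b.coord i y) • p i := by
      conv_lhs => rw [hx x, hx y]
      simp_rw [sub_smul, Finset.sum_sub_distrib]
    rw [dist_eq_norm, dist_eq_norm, ← sq_eq_sq₀ (norm_nonneg _) (norm_nonneg _), h1,
      hq.norm_sq_sum_smul h0, h2, hp.norm_sq_sum_smul h0]
  have hn : ∀ x, ‖f.linear x‖ = ‖x‖ := by
    intro x
    have := hdist x 0
    rw [dist_eq_norm, dist_zero_right] at this
    rw [← this, ← vsub_eq_sub (f x), ← f.linearMap_vsub]
    simp
  refine ⟨(⟨f, hn⟩ : E d →ᵃⁱ[ℝ] E d).toAffineIsometryEquiv rfl, fun i => ?_⟩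
  rw [AffineIsometry.coe_toAffineIsometryEquiv]
  change f (p i) = q i
  rw [hf]
  have hb : ∀ j, b.coord j (p i) = if j = i then 1 else 0 := fun j => b.coord_apply j i
  simp [hb]

theorem measurePreserving_affineIsometryEquiv (g : E d ≃ᵃⁱ[ℝ] E d) : MeasurePreserving g := by
  have h : ⇑g = (fun x => x + g 0) ∘ g.linearIsometryEquiv := by
    ext1 x
    have := g.map_vadd 0 x
    simpa using this
  rw [h]
  exact (measurePreserving_add_right volume (g 0)).comp g.linearIsometryEquiv.measurePreserving

theorem volume_preimage_affineIsometryEquiv (g : E d ≃ᵃⁱ[ℝ] E d) (s : Set (E d)) :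
    volume (g ⁻¹' s) = volume s :=
  (measurePreserving_affineIsometryEquiv g).measure_preimage_emb
    g.toHomeomorph.measurableEmbedding s

/-- The part of the simplex with vertices `p i` in which the distances to the vertices increase
with the index. -/
def chamber (p : Fin (d + 1) → E d) : Set (E d) :=
  {x | x ∈ convexHull ℝ (Set.range p) ∧ ∀ i j, i ≤ j → dist x (p i) ≤ dist x (p j)}

theorem isCompact_simplex (p : Fin (d + 1) → E d) : IsCompact (convexHull ℝ (Set.range p)) :=
  (Set.finite_range p).isCompact_convexHull ℝ

theorem isCompact_chamber (p : Fin (d + 1) → E d) : IsCompact (chamber p) := by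
  refine (isCompact_simplex p).of_isClosed_subset ?_ fun x hx => hx.1
  refine (isCompact_simplex p).isClosed.inter ?_
  have h : {x : E d | ∀ i j, i ≤ j → dist x (p i) ≤ dist x (p j)} =
      ⋂ i, ⋂ j, ⋂ _ : i ≤ j, {x | dist x (p i) ≤ dist x (p j)} := by ext; simp
  change IsClosed {x : E d | ∀ i j, i ≤ j → dist x (p i) ≤ dist x (p j)}
  rw [h]
  exact isClosed_iInter fun i => isClosed_iInter fun j => isClosed_iInter fun _ =>
    isClosed_le (by fun_prop) (by fun_prop)

theorem preimage_chamber (g : E d ≃ᵃⁱ[ℝ] E d) (p : Fin (d + 1) → E d) :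
    g ⁻¹' chamber (fun i => g (p i)) = chamber p := by
  ext x
  have h : Set.range (fun i => g (p i)) = g.toAffineEquiv.toAffineMap '' Set.range p := by
    rw [← Set.range_comp]; rfl
  have h2 : g x ∈ convexHull ℝ (Set.range fun i => g (p i)) ↔ x ∈ convexHull ℝ (Set.range p) := by
    rw [h, ← AffineMap.image_convexHull]
    exact g.injective.mem_set_image
  simp [chamber, h2]

/-- Sorting the vertices by their distance from a point names a chamber that contains it. -/
theorem iUnion_chamber_comp_perm (p : Fin (d + 1) → E d) :
    ⋃ π : Equiv.Perm (Fin (d + 1)), chamber (p ∘ π) = convexHull ℝ (Set.range p) := by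
  ext x
  simp only [Set.mem_iUnion, chamber, Set.mem_ofPred_eq, EquivLike.range_comp]
  constructor
  · rintro ⟨π, h, -⟩; exact h
  · intro h
    exact ⟨Tuple.sort fun i => dist x (p i), h,
      fun i j hij => Tuple.monotone_sort (fun i => dist x (p i)) hij⟩

theorem volume_perpBisector {x y : E d} (h : x ≠ y) :
    volume (AffineSubspace.perpBisector x y : Set (E d)) = 0 :=
  Measure.addHaar_affineSubspace _ _ (by simpa using h)

/-- A point that admits two different orderings is equidistant from two vertices, so it lies on one
of finitely many perpendicular bisectors. -/
theorem aedisjoint_chamber {p : Fin (d + 1) → E d} (hp : Function.Injective p)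
    {π ρ : Equiv.Perm (Fin (d + 1))} (h : π ≠ ρ) :
    AEDisjoint volume (chamber (p ∘ π)) (chamber (p ∘ ρ)) := by
  refine measure_mono_null (t := ⋃ i, ⋃ j, ⋃ _ : i ≠ j,
    (AffineSubspace.perpBisector (p i) (p j) : Set (E d))) ?_ ?_
  · rintro x ⟨⟨-, h1⟩, -, h2⟩
    by_contra hx
    simp only [Set.mem_iUnion, not_exists, SetLike.mem_coe,
      AffineSubspace.mem_perpBisector_iff_dist_eq] at hx
    have hinj : Function.Injective fun i => dist x (p i) := fun i j hij => by
      by_contra hne; exact hx i j hne hij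
    apply h
    -- Both permutations produce the same sorted tuple of distances; as the distances are distinct,
    -- they agree.
    have e1 := (Tuple.comp_sort_eq_comp_iff_monotone (f := fun i => dist x (p i)) (σ := π)).2
      fun i j hij => h1 i j hij
    have e2 := (Tuple.comp_sort_eq_comp_iff_monotone (f := fun i => dist x (p i)) (σ := ρ)).2
      fun i j hij => h2 i j hij
    ext i
    have := congrFun (e1.trans e2.symm) i
    exact congrArg Fin.val (hinj this)
  · simp only [measure_iUnion_null_iff]
    exact fun i j hij => volume_perpBisector (hp.ne hij)

/-- Each permutation of the vertices is induced by an isometry that preserves `A`, and it carries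
`chamber p` to the corresponding chamber. So all `(d + 1)!` pieces have equal volume. -/
theorem IsRegularSimplexOfEdgeTwo.volume_inter_eq {p : Fin (d + 1) → E d}
    (hp : IsRegularSimplexOfEdgeTwo p) {A : Set (E d)} (hA : MeasurableSet A)
    (hinv : ∀ (g : E d ≃ᵃⁱ[ℝ] E d) (π : Equiv.Perm (Fin (d + 1))),
      (∀ i, g (p i) = p (π i)) → g ⁻¹' A = A) :
    volume (convexHull ℝ (Set.range p) ∩ A) = (d + 1).factorial * volume (chamber p ∩ A) := by
  have hinj : Function.Injective p := hp.affineIndependent.injective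
  rw [← iUnion_chamber_comp_perm p, Set.iUnion_inter,
    measure_iUnion₀ (fun π ρ h => (aedisjoint_chamber hinj h).mono Set.inter_subset_left
      Set.inter_subset_left)
      fun π => ((isCompact_chamber _).measurableSet.inter hA).nullMeasurableSet,
    tsum_fintype]
  have key : ∀ π : Equiv.Perm (Fin (d + 1)),
      volume (chamber (p ∘ π) ∩ A) = volume (chamber p ∩ A) := by
    intro π
    have hq : IsRegularSimplexOfEdgeTwo (p ∘ π) := fun i j hij => hp _ _ (π.injective.ne hij)
    obtain ⟨g, hg⟩ := hp.exists_isometry hq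
    have h1 : (fun i => g (p i)) = p ∘ π := funext hg
    rw [← volume_preimage_affineIsometryEquiv g, Set.preimage_inter, ← h1, preimage_chamber,
      hinv g π hg]
  simp_rw [key]
  simp [Fintype.card_perm]

theorem chamber_inter_iUnion_closedBall (p : Fin (d + 1) → E d) :
    chamber p ∩ ⋃ i, Metric.closedBall (p i) 1 = chamber p ∩ Metric.closedBall (p 0) 1 := by
  ext x
  simp only [Set.mem_inter_iff, Set.mem_iUnion, Metric.mem_closedBall]
  refine and_congr_right fun hx => ⟨?_, fun h => ⟨0, h⟩⟩
  rintro ⟨i, hi⟩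
  exact (hx.2 0 i (Fin.zero_le i)).trans hi

theorem IsRegularSimplexOfEdgeTwo.simplexDensity_eq_chamber {p : Fin (d + 1) → E d}
    (hp : IsRegularSimplexOfEdgeTwo p) :
    simplexDensity p =
      volume.real (chamber p ∩ Metric.closedBall (p 0) 1) / volume.real (chamber p) := by
  have h1 := hp.volume_inter_eq MeasurableSet.univ fun g π _ => rfl
  have h2 := hp.volume_inter_eq (A := ⋃ i, Metric.closedBall (p i) 1)
    (.iUnion fun i => measurableSet_closedBall) fun g π hg => by
      ext x
      simp only [Set.mem_preimage, Set.mem_iUnion, Metric.mem_closedBall]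
      rw [← π.exists_congr_right]
      simp only [← hg, g.dist_map]
  simp only [Set.inter_univ] at h1
  rw [chamber_inter_iUnion_closedBall] at h2
  unfold simplexDensity Measure.real
  rw [h1, h2, ENNReal.toReal_mul, ENNReal.toReal_mul]
  refine mul_div_mul_left _ _ ?_
  simp [Nat.factorial_ne_zero]

theorem IsRegularSimplexOfEdgeTwo.simplexDensity_congr {p q : Fin (d + 1) → E d}
    (hp : IsRegularSimplexOfEdgeTwo p) (hq : IsRegularSimplexOfEdgeTwo q) :
    simplexDensity p = simplexDensity q := by
  obtain ⟨g, hg⟩ := hp.exists_isometry hq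
  obtain rfl : (fun i => g (p i)) = q := funext hg
  rw [hp.simplexDensity_eq_chamber, hq.simplexDensity_eq_chamber]
  have hball : g ⁻¹' Metric.closedBall (g (p 0)) 1 = Metric.closedBall (p 0) 1 := by
    ext x
    simp
  unfold Measure.real
  rw [← volume_preimage_affineIsometryEquiv g ((chamber fun i => g (p i)) ∩ _),
    ← volume_preimage_affineIsometryEquiv g (chamber fun i => g (p i)), Set.preimage_inter,
    preimage_chamber, hball]

theorem IsRegularSimplexOfEdgeTwo.volume_chamber_pos {p : Fin (d + 1) → E d}
    (hp : IsRegularSimplexOfEdgeTwo p) : 0 < volume (chamber p) := by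
  have h1 := hp.volume_inter_eq MeasurableSet.univ fun g π _ => rfl
  simp only [Set.inter_univ] at h1
  have h2 : 0 < volume (convexHull ℝ (Set.range p)) := by
    have : (interior (convexHull ℝ (Set.range p))).Nonempty :=
      ⟨_, hp.affineBasis.centroid_mem_interior_convexHull⟩
    exact (isOpen_interior.measure_pos volume this).trans_le (measure_mono interior_subset)
  rw [h1] at h2
  exact pos_iff_ne_zero.2 (right_ne_zero_of_mul h2.ne')

end

/-! ### The Rogers orthoscheme is a chamber -/

section

variable {d : ℕ}

/-- Only the term `-4 * a j` depends on `j`: nearer vertices are those with larger barycentric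
coordinates. -/
theorem IsRegularSimplexOfEdgeTwo.dist_sq_sum_smul {p : Fin (d + 1) → E d}
    (hp : IsRegularSimplexOfEdgeTwo p) {a : Fin (d + 1) → ℝ} (ha : ∑ i, a i = 1)
    (j : Fin (d + 1)) :
    dist (∑ i, a i • p i) (p j) ^ 2 = 2 * ∑ i, a i ^ 2 - 4 * a j + 2 := by
  have h0 : ∑ i, (a i - if i = j then 1 else 0) = 0 := by
    simp [Finset.sum_sub_distrib, ha]
  have h := hp.norm_sq_sum_smul h0
  have h1 : ∑ i, (a i - if i = j then 1 else 0) • p i = ∑ i, a i • p i - p j := by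
    simp [sub_smul, Finset.sum_sub_distrib]
  have h2 : ∀ i, (a i - if i = j then (1 : ℝ) else 0) ^ 2 =
      a i ^ 2 + if i = j then 1 - 2 * a i else 0 := by
    intro i; split_ifs <;> ring
  rw [h1] at h
  simp_rw [dist_eq_norm, h, h2, Finset.sum_add_distrib, Finset.sum_ite_eq', Finset.mem_univ,
    if_true]
  ring

theorem convex_setOf_dist_le_dist (p q : E d) : Convex ℝ {x | dist x p ≤ dist x q} := by
  have h : {x | dist x p ≤ dist x q} =
      {x | (innerSL ℝ (q - p)) x ≤ (‖q‖ ^ 2 - ‖p‖ ^ 2) / 2} := by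
    ext x
    simp only [Set.mem_ofPred_eq, innerSL_apply_apply]
    rw [← sq_le_sq₀ dist_nonneg dist_nonneg, dist_eq_norm, dist_eq_norm, norm_sub_sq_real,
      norm_sub_sq_real, inner_sub_left, real_inner_comm x q, real_inner_comm x p]
    constructor <;> intro h <;> linarith
  rw [h]
  exact convex_halfSpace_le (innerSL ℝ (q - p)).isLinear _

theorem convex_chamber (p : Fin (d + 1) → E d) : Convex ℝ (chamber p) := by
  have h : chamber p = convexHull ℝ (Set.range p) ∩
      ⋂ i, ⋂ j, ⋂ _ : i ≤ j, {x | dist x (p i) ≤ dist x (p j)} := by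
    ext; simp [chamber]
  rw [h]
  exact (convex_convexHull ℝ _).inter <| convex_iInter fun i => convex_iInter fun j =>
    convex_iInter fun _ => convex_setOf_dist_le_dist _ _

/-- The vertices `0, …, d` of an orthoscheme that is a chamber of a regular simplex of edge
length `2`, in terms of their inner products. -/
structure IsRogersOrthoscheme (v : ℕ → E d) : Prop where
  inner_eq : ∀ i j : ℕ, i ≤ j → j ≤ d → inner ℝ (v i) (v j) = 2 * (i : ℝ) / ((i : ℝ) + 1)

/-- The vertices of the regular simplex of which `v 0, v 1, …` are the centres of the faces
of a flag. -/
def simplexVertex (v : ℕ → E d) (k : ℕ) : E d := ((k : ℝ) + 1) • v k - (k : ℝ) • v (k - 1)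

/-- Abel summation, turning coordinates with respect to the simplex vertices into coordinates with
respect to the face centres. The truncated index `k - 1` at `k = 0` is harmless, since its
coefficient vanishes. -/
theorem sum_simplexVertex (v : ℕ → E d) (a : ℕ → ℝ) (n : ℕ) :
    ∑ k ∈ Finset.range (n + 1), a k • simplexVertex v k =
      ∑ k ∈ Finset.range (n + 1), ((a k - a (k + 1)) * ((k : ℝ) + 1)) • v k +
        (a (n + 1) * ((n : ℝ) + 1)) • v n := by
  induction n with
  | zero => simp [simplexVertex, ← add_smul]
  | succ n ih =>
    rw [Finset.sum_range_succ, ih, Finset.sum_range_succ _ (n + 1), add_assoc, add_assoc]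
    congr 1
    simp only [simplexVertex, Nat.add_sub_cancel, smul_sub, smul_smul]
    push_cast
    module

theorem sum_eq_sum_weights (a : ℕ → ℝ) (n : ℕ) :
    ∑ k ∈ Finset.range (n + 1), a k =
      ∑ k ∈ Finset.range (n + 1), (a k - a (k + 1)) * ((k : ℝ) + 1) +
        a (n + 1) * ((n : ℝ) + 1) := by
  induction n with
  | zero => simp
  | succ n ih =>
    rw [Finset.sum_range_succ, ih, Finset.sum_range_succ _ (n + 1)]
    push_cast
    ring

namespace IsRogersOrthoscheme

variable {v : ℕ → E d}

theorem inner_simplexVertex_of_lt (hv : IsRogersOrthoscheme v) {i j : ℕ} (hij : i < j)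
    (hj : j ≤ d) : inner ℝ (v i) (simplexVertex v j) = 2 * (i : ℝ) / ((i : ℝ) + 1) := by
  rw [simplexVertex, inner_sub_right, inner_smul_right, inner_smul_right,
    hv.inner_eq i j hij.le hj, hv.inner_eq i (j - 1) (by omega) (by omega)]
  ring

theorem inner_simplexVertex_of_le (hv : IsRogersOrthoscheme v) {i j : ℕ} (hi : 1 ≤ i)
    (hij : i ≤ j) (hj : j ≤ d) : inner ℝ (v j) (simplexVertex v i) = 2 := by
  obtain ⟨i, rfl⟩ : ∃ k, i = k + 1 := ⟨i - 1, by omega⟩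
  rw [simplexVertex, inner_sub_right, inner_smul_right, inner_smul_right, real_inner_comm,
    hv.inner_eq _ j hij hj, Nat.add_sub_cancel, real_inner_comm, hv.inner_eq i j (by omega) hj]
  have : (i : ℝ) + 1 + 1 ≠ 0 := by positivity
  push_cast
  field_simp
  ring

@[simp] theorem simplexVertex_zero (hv : IsRogersOrthoscheme v) : simplexVertex v 0 = 0 := by
  have := hv.inner_eq 0 0 le_rfl (Nat.zero_le d)
  have h : v 0 = 0 := by simpa using this
  simp [simplexVertex, h]

theorem inner_simplexVertex_simplexVertex_of_lt (hv : IsRogersOrthoscheme v) {i j : ℕ}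
    (hi : 1 ≤ i) (hij : i < j) (hj : j ≤ d) :
    inner ℝ (simplexVertex v i) (simplexVertex v j) = 2 := by
  obtain ⟨i, rfl⟩ : ∃ k, i = k + 1 := ⟨i - 1, by omega⟩
  rw [simplexVertex, inner_sub_left, inner_smul_left, inner_smul_left,
    hv.inner_simplexVertex_of_lt hij hj, Nat.add_sub_cancel,
    hv.inner_simplexVertex_of_lt (by omega : i < j) hj]
  have : (i : ℝ) + 1 + 1 ≠ 0 := by positivity
  simp only [conj_trivial]
  push_cast
  field_simp
  ring

theorem norm_sq_simplexVertex (hv : IsRogersOrthoscheme v) {i : ℕ} (hi : 1 ≤ i) (hd : i ≤ d) :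
    ‖simplexVertex v i‖ ^ 2 = 4 := by
  obtain ⟨i, rfl⟩ : ∃ k, i = k + 1 := ⟨i - 1, by omega⟩
  rw [← real_inner_self_eq_norm_sq]
  nth_rewrite 1 [simplexVertex]
  rw [inner_sub_left, inner_smul_left, inner_smul_left,
    hv.inner_simplexVertex_of_le hi le_rfl hd, Nat.add_sub_cancel,
    hv.inner_simplexVertex_of_lt (by omega : i < i + 1) hd]
  simp only [conj_trivial]
  push_cast
  field_simp
  ring

theorem isRegularSimplexOfEdgeTwo (hv : IsRogersOrthoscheme v) :
    IsRegularSimplexOfEdgeTwo fun i : Fin (d + 1) => simplexVertex v i := by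
  have key : ∀ i j : ℕ, i < j → j ≤ d → dist (simplexVertex v i) (simplexVertex v j) = 2 := by
    intro i j hij hj
    rw [← sq_eq_sq₀ dist_nonneg (by norm_num), dist_eq_norm, norm_sub_sq_real,
      hv.norm_sq_simplexVertex (by omega) hj]
    rcases Nat.eq_zero_or_pos i with rfl | hi
    · simp [hv]; norm_num
    · rw [hv.norm_sq_simplexVertex hi (by omega),
        hv.inner_simplexVertex_simplexVertex_of_lt hi hij hj]
      norm_num
  intro i j hij
  rcases lt_or_gt_of_ne hij with h | h
  · exact key i j h (by omega)
  · rw [dist_comm]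
    exact key j i h (by omega)

theorem mem_convexHull_simplexVertex {k : ℕ} (hk : k ≤ d) :
    v k ∈ convexHull ℝ (Set.range fun i : Fin (d + 1) => simplexVertex v i) := by
  induction k with
  | zero => exact subset_convexHull _ _ ⟨0, by simp [simplexVertex]⟩
  | succ k ih =>
    have h1 : simplexVertex v (k + 1) ∈
        convexHull ℝ (Set.range fun i : Fin (d + 1) => simplexVertex v i) :=
      subset_convexHull _ _ ⟨⟨k + 1, by omega⟩, rfl⟩
    have h2 := (convex_convexHull ℝ _) (ih (by omega)) h1
      (a := ((k : ℝ) + 1) / (k + 2)) (b := 1 / ((k : ℝ) + 2)) (by positivity) (by positivity)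
      (by field_simp; ring)
    convert h2 using 1
    rw [simplexVertex, Nat.add_sub_cancel, smul_sub, smul_smul, smul_smul]
    have : ((k : ℝ) + 2) ≠ 0 := by positivity
    push_cast
    rw [show 1 / ((k : ℝ) + 2) * (k + 1 + 1) = 1 by field_simp; ring,
      show 1 / ((k : ℝ) + 2) * (k + 1) = (k + 1) / (k + 2) by ring]
    module

theorem mem_chamber (hv : IsRogersOrthoscheme v) {k : ℕ} (hk : k ≤ d) :
    v k ∈ chamber fun i : Fin (d + 1) => simplexVertex v i := by
  refine ⟨mem_convexHull_simplexVertex hk, ?_⟩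
  -- The centre of the face spanned by the vertices `0, …, k` is equidistant from these vertices,
  -- and no nearer to the remaining ones.
  have hdist : ∀ i : ℕ, i ≤ d → dist (v k) (simplexVertex v i) ^ 2 =
      ‖v k‖ ^ 2 + if i ≤ k then 0 else 4 - 4 * (k : ℝ) / (k + 1) := by
    intro i hi
    rw [dist_eq_norm, norm_sub_sq_real]
    split_ifs with hik
    · rcases Nat.eq_zero_or_pos i with rfl | hi0
      · simp [hv]
      · rw [hv.norm_sq_simplexVertex hi0 hi, hv.inner_simplexVertex_of_le hi0 hik hk]
        ring
    · rw [hv.norm_sq_simplexVertex (by omega) hi, hv.inner_simplexVertex_of_lt (by omega) hi]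
      ring
  have hpos : 0 ≤ 4 - 4 * (k : ℝ) / (k + 1) := by
    rw [sub_nonneg, div_le_iff₀ (by positivity)]
    linarith
  intro i j hij
  have hij' : (i : ℕ) ≤ j := hij
  rw [← sq_le_sq₀ dist_nonneg dist_nonneg, hdist i (by omega), hdist j (by omega)]
  split_ifs
  · rfl
  · linarith
  · omega
  · rfl

/-- In the chamber the barycentric coordinates decrease with the index, so the weights `(a k - a (k
+ 1)) * (k + 1)` given by Abel summation are nonnegative and sum to 1. -/
theorem chamber_eq (hv : IsRogersOrthoscheme v) :
    (chamber fun i : Fin (d + 1) => simplexVertex v i) = convexHull ℝ (v '' Set.Iic d) := by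
  apply Set.Subset.antisymm
  · rintro x ⟨hx, hdist⟩
    have hreg := hv.isRegularSimplexOfEdgeTwo
    obtain ⟨b, hb0, hb1, rfl⟩ : ∃ b : Fin (d + 1) → ℝ, (∀ i, 0 ≤ b i) ∧ ∑ i, b i = 1 ∧
        x = ∑ i, b i • simplexVertex v i := by
      refine ⟨fun i => hreg.affineBasis.coord i x, ?_, hreg.affineBasis.sum_coord_apply_eq_one x,
        (hreg.affineBasis.linear_combination_coord_eq_self x).symm⟩
      have := hreg.affineBasis.convexHull_eq_nonneg_coord
      rw [hreg.coe_affineBasis] at this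
      rwa [this] at hx
    have hanti : ∀ i j, i ≤ j → b j ≤ b i := by
      intro i j hij
      have h := hdist i j hij
      rw [← sq_le_sq₀ dist_nonneg dist_nonneg, hreg.dist_sq_sum_smul hb1,
        hreg.dist_sq_sum_smul hb1] at h
      linarith
    -- Padding by 0 makes the last difference `a d - a (d + 1)` equal to `a d`, and removes the
    -- boundary term.
    set a : ℕ → ℝ := fun k => if h : k < d + 1 then b ⟨k, h⟩ else 0 with ha
    have hab : ∀ i : Fin (d + 1), b i = a i := fun i => by simp only [ha, i.is_lt, dif_pos]
    have had : a (d + 1) = 0 := by simp [ha]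
    have hstep : ∀ k ∈ Finset.range (d + 1), 0 ≤ (a k - a (k + 1)) * ((k : ℝ) + 1) := by
      intro k hk
      have hk := Finset.mem_range.1 hk
      refine mul_nonneg ?_ (by positivity)
      simp only [ha, hk, dif_pos]
      split_ifs with h
      · exact sub_nonneg.2 (hanti _ _ (by simp))
      · simpa using hb0 _
    have hsum : ∑ i, b i • simplexVertex v i =
        ∑ k ∈ Finset.range (d + 1), a k • simplexVertex v k := by
      simp_rw [hab, Finset.sum_range]
    have hsum1 : ∑ k ∈ Finset.range (d + 1), a k = 1 := by
      rw [← hb1]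
      simp_rw [hab, Finset.sum_range]
    rw [hsum, sum_simplexVertex, had, zero_mul, zero_smul, add_zero]
    rw [sum_eq_sum_weights, had, zero_mul, add_zero] at hsum1
    exact (convex_convexHull ℝ _).sum_mem hstep hsum1 fun k hk =>
      subset_convexHull _ _ ⟨k, Nat.lt_succ_iff.1 (Finset.mem_range.1 hk), rfl⟩
  · refine convexHull_min ?_ (convex_chamber _)
    rintro _ ⟨k, hk, rfl⟩
    exact hv.mem_chamber hk

theorem simplexDensity_eq (hv : IsRogersOrthoscheme v) {p : Fin (d + 1) → E d}
    (hp : IsRegularSimplexOfEdgeTwo p) :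
    simplexDensity p =
      volume.real (convexHull ℝ (v '' Set.Iic d) ∩ Metric.closedBall 0 1) /
        volume.real (convexHull ℝ (v '' Set.Iic d)) := by
  rw [hp.simplexDensity_congr hv.isRegularSimplexOfEdgeTwo,
    hv.isRegularSimplexOfEdgeTwo.simplexDensity_eq_chamber, hv.chamber_eq]
  simp [hv]

theorem volume_pos (hv : IsRogersOrthoscheme v) : 0 < volume (convexHull ℝ (v '' Set.Iic d)) := by
  rw [← hv.chamber_eq]
  exact hv.isRegularSimplexOfEdgeTwo.volume_chamber_pos

end IsRogersOrthoscheme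

end

/-! ### Joins as families of dilated slices, and their volume -/

section

open scoped Pointwise

variable {V : Type*} [NormedAddCommGroup V] [InnerProductSpace ℝ V]

/-- The function `φ` is positively homogeneous, and positive on the cone `K` except at the
origin. -/
structure IsConeGauge (K : Set V) (φ : V → ℝ) : Prop where
  zero_mem : 0 ∈ K
  smul_mem : ∀ t : ℝ, 0 ≤ t → ∀ v ∈ K, t • v ∈ K
  map_smul : ∀ t : ℝ, 0 ≤ t → ∀ v, φ (t • v) = t * φ v
  eq_zero : ∀ v ∈ K, φ v ≤ 0 → v = 0

/-- The convex cone spanned by two vectors. -/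
def cone (a b : V) : Set V := {v | ∃ s t : ℝ, 0 ≤ s ∧ 0 ≤ t ∧ v = s • a + t • b}

theorem zero_mem_cone (a b : V) : (0 : V) ∈ cone a b := ⟨0, 0, le_rfl, le_rfl, by simp⟩

theorem smul_mem_cone {a b v : V} (hv : v ∈ cone a b) {t : ℝ} (ht : 0 ≤ t) :
    t • v ∈ cone a b := by
  obtain ⟨p, q, hp, hq, rfl⟩ := hv
  exact ⟨t * p, t * q, mul_nonneg ht hp, mul_nonneg ht hq, by module⟩

theorem convex_cone (a b : V) : Convex ℝ (cone a b) := by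
  rintro _ ⟨p, q, hp, hq, rfl⟩ _ ⟨p', q', hp', hq', rfl⟩ s t hs ht -
  exact ⟨s * p + t * p', s * q + t * q', by positivity, by positivity, by module⟩

theorem cone_subset {P : Submodule ℝ V} {a b : V} (ha : a ∈ P) (hb : b ∈ P) :
    cone a b ⊆ P := by
  rintro _ ⟨p, q, -, -, rfl⟩
  exact add_mem (P.smul_mem _ ha) (P.smul_mem _ hb)

theorem isClosed_cone {a b : V} (h : LinearIndependent ℝ ![a, b]) : IsClosed (cone a b) := by
  let L : ℝ × ℝ →ₗ[ℝ] V :=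
    (LinearMap.toSpanSingleton ℝ V a).coprod (LinearMap.toSpanSingleton ℝ V b)
  have hL : ∀ p, L p = p.1 • a + p.2 • b := fun p => rfl
  have hinj : Function.Injective L := by
    rw [injective_iff_map_eq_zero]
    rintro ⟨p, q⟩ hpq
    obtain ⟨rfl, rfl⟩ := LinearIndependent.pair_iff.1 h p q hpq
    rfl
  have hcone : cone a b = L '' (Set.Ici 0 ×ˢ Set.Ici 0) := by
    ext v
    constructor
    · rintro ⟨p, q, hp, hq, rfl⟩
      exact ⟨(p, q), ⟨hp, hq⟩, rfl⟩
    · rintro ⟨⟨p, q⟩, ⟨hp, hq⟩, rfl⟩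
      exact ⟨p, q, hp, hq, rfl⟩
  rw [hcone]
  exact (LinearMap.isClosedEmbedding_of_injective (LinearMap.ker_eq_bot.2 hinj)).isClosedMap _
    (isClosed_Ici.prod isClosed_Ici)

theorem isConeGauge_norm (a b : V) {r : ℝ} (hr : 0 < r) :
    IsConeGauge (cone a b) fun v => ‖v‖ / r where
  zero_mem := zero_mem_cone a b
  smul_mem _ ht _ hv := smul_mem_cone hv ht
  map_smul t ht v := by rw [norm_smul, Real.norm_of_nonneg ht, mul_div_assoc]
  eq_zero v _ h := by
    have := (div_le_iff₀ hr).1 h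
    rw [zero_mul] at this
    exact norm_le_zero_iff.1 this

/-- Homogeneity gives this for `r > 0`; for `r = 0` both sides are `{0}`, because the gauge is
positive on the cone away from the origin. -/
theorem IsConeGauge.setOf_le_eq_smul {K : Set V} {φ : V → ℝ} (h : IsConeGauge K φ)
    (P : Submodule ℝ V) {r : ℝ} (hr : 0 ≤ r) :
    {v : P | (v : V) ∈ K ∧ φ v ≤ r} = r • {v : P | (v : V) ∈ K ∧ φ v ≤ 1} := by
  have hφ0 : φ 0 = 0 := by simpa using h.map_smul 0 le_rfl 0
  ext v
  rw [Set.mem_smul_set]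
  constructor
  · rintro ⟨hv, hle⟩
    rcases hr.eq_or_lt with rfl | hr
    · exact ⟨0, ⟨h.zero_mem, by simp [hφ0]⟩, by
        rw [smul_zero]; exact (Subtype.ext (h.eq_zero _ hv hle)).symm⟩
    · refine ⟨r⁻¹ • v, ⟨h.smul_mem _ (by positivity) _ hv, ?_⟩, smul_inv_smul₀ hr.ne' v⟩
      rw [Submodule.coe_smul, h.map_smul _ (by positivity), inv_mul_le_iff₀ hr, mul_one]
      exact hle
  · rintro ⟨w, ⟨hw, hle⟩, rfl⟩
    refine ⟨h.smul_mem _ hr _ hw, ?_⟩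
    rw [Submodule.coe_smul, h.map_smul _ hr]
    exact mul_le_of_le_one_right hr hle

variable [FiniteDimensional ℝ V] [MeasurableSpace V] [BorelSpace V]

theorem volume_eq_lintegral_slices (P : Submodule ℝ V) {Z : Set V} (hZ : MeasurableSet Z) :
    volume Z = ∫⁻ y : Pᗮ, volume {v : P | (v : V) + (y : V) ∈ Z} := by
  have h1 := P.orthogonalDecomposition.symm.measurePreserving.comp
    (WithLp.volume_preserving_toLp P Pᗮ)
  rw [← h1.measure_preimage hZ.nullMeasurableSet, Measure.volume_eq_prod,
    Measure.prod_apply_symm (h1.measurable hZ)]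
  refine lintegral_congr fun y => ?_
  simp [Set.preimage]

/-- The points whose component orthogonal to `P` lies in `X` and whose component `v` in `P` lies
in the cone `K` with `φ v` bounded by the value of `f` at the orthogonal component. -/
def sliceSet (P : Submodule ℝ V) (X K : Set V) (φ f : V → ℝ) : Set V :=
  {z | z - P.starProjection z ∈ X ∧ P.starProjection z ∈ K ∧
    φ (P.starProjection z) ≤ f (z - P.starProjection z)}

theorem measurableSet_sliceSet (P : Submodule ℝ V) {X K : Set V} {φ f : V → ℝ}
    (hX : MeasurableSet X) (hK : MeasurableSet K) (hφ : Continuous φ) (hf : Continuous f) :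
    MeasurableSet (sliceSet P X K φ f) := by
  have h1 : Continuous fun z => P.starProjection z := P.starProjection.continuous
  have h2 : Continuous fun z => z - P.starProjection z := continuous_id.sub h1
  exact (h2.measurable hX).inter ((h1.measurable hK).inter
    (isClosed_le (hφ.comp h1) (hf.comp h2)).measurableSet)

/-- By Fubini, since the slice over `y` is the unit sublevel set dilated by `f y`. The point is that
the planar shape and the height function enter as separate factors. -/
theorem volume_sliceSet (P : Submodule ℝ V) {X K : Set V} {φ f : V → ℝ}
    (hX : MeasurableSet X) (hK : MeasurableSet K) (hφ : Continuous φ) (hf : Continuous f)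
    (h : IsConeGauge K φ) (hf0 : ∀ y ∈ X, 0 ≤ f y) :
    volume (sliceSet P X K φ f) = volume {v : P | (v : V) ∈ K ∧ φ v ≤ 1} *
      ∫⁻ y : Pᗮ in {y : Pᗮ | (y : V) ∈ X}, ENNReal.ofReal (f y ^ finrank ℝ P) := by
  have hX' : MeasurableSet {y : Pᗮ | (y : V) ∈ X} := measurable_subtype_coe hX
  rw [volume_eq_lintegral_slices P (measurableSet_sliceSet P hX hK hφ hf),
    ← lintegral_indicator hX', ← lintegral_const_mul]
  · refine lintegral_congr fun y => ?_
    have hproj : ∀ v : P, P.starProjection ((v : V) + y) = v := by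
      intro v
      rw [map_add, Submodule.starProjection_eq_self_iff.2 v.2,
        (Submodule.starProjection_apply_eq_zero_iff P).2 y.2, add_zero]
    have hset : {v : P | (v : V) + (y : V) ∈ sliceSet P X K φ f} =
        {v : P | (y : V) ∈ X ∧ (v : V) ∈ K ∧ φ v ≤ f y} := by
      ext v
      simp only [sliceSet, Set.mem_ofPred_eq, hproj, add_sub_cancel_left]
    rw [hset]
    by_cases hy : (y : V) ∈ X
    · have := h.setOf_le_eq_smul P (hf0 _ hy)
      simp only [hy, true_and, this]
      rw [Measure.addHaar_smul, Set.indicator_of_mem (by exact hy), mul_comm,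
        abs_of_nonneg (pow_nonneg (hf0 _ hy) _)]
    · simp [hy]
  · exact (ENNReal.measurable_ofReal.comp
      ((hf.comp continuous_subtype_val).pow _).measurable).indicator hX'

omit [MeasurableSpace V] [BorelSpace V] in
-- A point `s • x + t • (c + v)` has component `t • v` in `P` and component `s • x + t • c`
-- orthogonal to it. The functional `u` vanishes on `C` and is 1 at `c`, so it recovers the dilation
-- factor `t`.
theorem convexJoin_eq_sliceSet {P : Submodule ℝ V} {C K : Set V} {c u : V} {φ : V → ℝ}
    (h : IsConeGauge K φ) (hKP : K ⊆ P) (hC : ∀ z ∈ C, z ∈ Pᗮ) (hc : c ∈ Pᗮ)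
    (hCu : ∀ z ∈ C, inner ℝ z u = 0) (hcu : inner ℝ c u = 1) :
    convexJoin ℝ C ((fun v => c + v) '' {v | v ∈ K ∧ φ v ≤ 1}) =
      sliceSet P (convexJoin ℝ C {c}) K φ fun y => inner ℝ y u := by
  have hφ0 : φ 0 = 0 := by simpa using h.map_smul 0 le_rfl 0
  ext z
  constructor
  · intro hz
    obtain ⟨x, hx, _, ⟨v, ⟨hv, hv1⟩, rfl⟩, s, t, hs, ht, hst, rfl⟩ := mem_convexJoin.1 hz
    have hp : P.starProjection (s • x + t • (c + v)) = t • v := by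
      have : s • x + t • (c + v) = (s • x + t • c) + t • v := by module
      rw [this, map_add, (Submodule.starProjection_apply_eq_zero_iff P).2
        (add_mem (Pᗮ.smul_mem _ (hC x hx)) (Pᗮ.smul_mem _ hc)),
        Submodule.starProjection_eq_self_iff.2 (P.smul_mem _ (hKP hv)), zero_add]
    have hy : s • x + t • (c + v) - t • v = s • x + t • c := by module
    refine ⟨?_, ?_, ?_⟩
    · rw [hp, hy]
      exact mem_convexJoin.2 ⟨x, hx, c, rfl, s, t, hs, ht, hst, rfl⟩
    · rw [hp]; exact h.smul_mem t ht v hv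
    · simp only [hp, hy]
      rw [h.map_smul t ht, inner_add_left, inner_smul_left, inner_smul_left, hCu x hx, hcu]
      simpa using mul_le_of_le_one_right ht hv1
  · rintro ⟨hX, hK, hle⟩
    set v := P.starProjection z
    obtain ⟨x, hx, s, t, hs, ht, hst, hz⟩ : ∃ x ∈ C, z - v ∈ segment ℝ x c := by
      simpa [mem_convexJoin] using hX
    have hT : inner ℝ (z - v) u = t := by
      rw [← hz, inner_add_left, inner_smul_left, inner_smul_left, hCu x hx, hcu]
      simp
    simp only [hT] at hle
    have hz' : z = s • x + t • c + v := by rw [hz]; abel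
    rw [mem_convexJoin]
    -- At `t = 0` one cannot divide by `t`, but the slice is the single point 0.
    rcases ht.eq_or_lt with rfl | ht0
    · have hv0 : v = 0 := h.eq_zero v hK hle
      refine ⟨x, hx, c + 0, ⟨0, ⟨h.zero_mem, by simp [hφ0]⟩, rfl⟩, s, 0, hs, le_rfl, hst, ?_⟩
      rw [hz', hv0]; simp
    · refine ⟨x, hx, c + t⁻¹ • v, ⟨t⁻¹ • v, ⟨h.smul_mem _ (by positivity) _ hK, ?_⟩, rfl⟩,
        s, t, hs, ht, hst, ?_⟩
      · rw [h.map_smul _ (by positivity), inv_mul_le_iff₀ ht0, mul_one]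
        exact hle
      · rw [hz', smul_add, smul_inv_smul₀ ht0.ne', add_assoc]

theorem volume_sector_pos {P : Submodule ℝ V} {a b : V} (ha : a ∈ P) (hb : b ∈ P)
    (hP : ∀ v ∈ P, ∃ p q : ℝ, v = p • a + q • b) {r : ℝ} (hr : 0 < r) :
    0 < volume {v : P | (v : V) ∈ cone a b ∧ ‖(v : V)‖ / r ≤ 1} := by
  let L : ℝ × ℝ →ₗ[ℝ] P :=
    (LinearMap.toSpanSingleton ℝ P ⟨a, ha⟩).coprod (LinearMap.toSpanSingleton ℝ P ⟨b, hb⟩)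
  have hL : ∀ p, (L p : V) = p.1 • a + p.2 • b := fun p => rfl
  have hsurj : Function.Surjective L := fun v => by
    obtain ⟨p, q, h⟩ := hP v v.2
    exact ⟨(p, q), Subtype.ext h.symm⟩
  have hopen : IsOpen (L '' ((Set.Ioi 0 ×ˢ Set.Ioi 0) ∩ L ⁻¹' Metric.ball 0 r)) := by
    refine L.isOpenMap_of_finiteDimensional hsurj _ ?_
    exact (isOpen_Ioi.prod isOpen_Ioi).inter
      (Metric.isOpen_ball.preimage L.continuous_of_finiteDimensional)
  have hne : (L '' ((Set.Ioi 0 ×ˢ Set.Ioi 0) ∩ L ⁻¹' Metric.ball 0 r)).Nonempty := by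
    refine Set.Nonempty.image _ ?_
    refine ⟨(r / (2 * (‖a‖ + ‖b‖ + 1))) • (1, 1), ⟨?_, ?_⟩, ?_⟩
    · simp; positivity
    · simp; positivity
    · rw [Set.mem_preimage, mem_ball_zero_iff, map_smul, norm_smul,
        Real.norm_of_nonneg (by positivity)]
      have h1 : ‖L (1, 1)‖ ≤ ‖a‖ + ‖b‖ := by
        change ‖(L (1, 1) : V)‖ ≤ _
        rw [hL]
        simpa using norm_add_le a b
      have h2 : ‖a‖ + ‖b‖ + 1 > 0 := by positivity
      calc r / (2 * (‖a‖ + ‖b‖ + 1)) * ‖L (1, 1)‖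
          ≤ r / (2 * (‖a‖ + ‖b‖ + 1)) * (‖a‖ + ‖b‖ + 1) := by gcongr; linarith
        _ = r / 2 := by field_simp
        _ < r := by linarith
  refine (hopen.measure_pos volume hne).trans_le (measure_mono ?_)
  rintro _ ⟨⟨p, q⟩, ⟨⟨hp, hq⟩, hn⟩, rfl⟩
  refine ⟨⟨p, q, le_of_lt hp, le_of_lt hq, rfl⟩, ?_⟩
  rw [div_le_one hr]
  exact (mem_ball_zero_iff.1 hn).le

end

/-! ### Planar geometry of the triangle and the sector -/

section

variable {V : Type*} [NormedAddCommGroup V] [InnerProductSpace ℝ V]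

/-- A convex base `C`, an apex `c` and vectors `e`, `a`, `b` in a plane orthogonal to `C` and `c`,
such that `0, e, a` is a triangle with a right angle at `e` and `0, a, b` spans a circular sector
on the other side of `a`. The linear functional given by `u` separates `c` from `C`. -/
structure IsWedgeConfig (C : Set V) (c e a b u : V) : Prop where
  isCompact : IsCompact C
  convex : Convex ℝ C
  zero_mem : 0 ∈ C
  inner_base_e : ∀ z ∈ C, inner ℝ z e = 0
  inner_base_a : ∀ z ∈ C, inner ℝ z a = 0
  inner_base_u : ∀ z ∈ C, inner ℝ z u = 0
  inner_apex_e : inner ℝ c e = 0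
  inner_apex_a : inner ℝ c a = 0
  inner_apex_u : inner ℝ c u = 1
  inner_e_a : inner ℝ e a = ‖e‖ ^ 2
  norm_e_pos : 0 < ‖e‖
  norm_e_lt : ‖e‖ < ‖a‖
  exists_eq : ∃ x y : ℝ, 0 < x ∧ 0 < y ∧ b = y • a - x • e
  norm_b : ‖b‖ = ‖a‖
  one_le_norm : 1 ≤ ‖c + e‖

/-- The triangle with vertices `0`, `e`, `a` if `e` is orthogonal to `a - e`. -/
def triangleSet (e a : V) : Set V := {v | v ∈ cone e a ∧ inner ℝ v e / ‖e‖ ^ 2 ≤ 1}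

/-- The circular sector with centre `0` between the vectors `a` and `b`. -/
def sectorSet (a b : V) : Set V := {v | v ∈ cone a b ∧ ‖v‖ / ‖a‖ ≤ 1}

namespace IsWedgeConfig

variable {C : Set V} {c e a b u : V}

theorem norm_a_pos (h : IsWedgeConfig C c e a b u) : 0 < ‖a‖ := h.norm_e_pos.trans h.norm_e_lt

theorem inner_add_e (h : IsWedgeConfig C c e a b u) (p q : ℝ) :
    inner ℝ (p • e + q • a) e = (p + q) * ‖e‖ ^ 2 := by
  rw [inner_add_left, inner_smul_left, inner_smul_left, real_inner_self_eq_norm_sq,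
    real_inner_comm, h.inner_e_a]
  simp only [conj_trivial]
  ring

theorem norm_sq_add (h : IsWedgeConfig C c e a b u) (p q : ℝ) :
    ‖p • e + q • a‖ ^ 2 = p ^ 2 * ‖e‖ ^ 2 + 2 * p * q * ‖e‖ ^ 2 + q ^ 2 * ‖a‖ ^ 2 := by
  rw [norm_add_sq_real, norm_smul, norm_smul, inner_smul_left, inner_smul_right, h.inner_e_a,
    mul_pow, mul_pow, Real.norm_eq_abs, Real.norm_eq_abs, sq_abs, sq_abs]
  simp only [conj_trivial]
  ring

theorem norm_sq_lt (h : IsWedgeConfig C c e a b u) : ‖e‖ ^ 2 < ‖a‖ ^ 2 :=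
  (sq_lt_sq₀ (norm_nonneg _) (norm_nonneg _)).2 h.norm_e_lt

theorem linearIndependent_e_a (h : IsWedgeConfig C c e a b u) :
    LinearIndependent ℝ ![e, a] := by
  rw [LinearIndependent.pair_iff]
  intro s t hst
  have h1 := h.inner_add_e s t
  have h2 := h.norm_sq_add s t
  have he := h.norm_e_pos
  have hlt := h.norm_sq_lt
  rw [hst, inner_zero_left] at h1
  rw [hst, norm_zero] at h2
  have h3 : s + t = 0 := by
    rcases mul_eq_zero.1 h1.symm with h | h
    · exact h
    · exact absurd h (by positivity)
  have h4 : s = -t := by linarith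
  subst h4
  have h5 : t ^ 2 * (‖a‖ ^ 2 - ‖e‖ ^ 2) = 0 := by linarith
  rcases mul_eq_zero.1 h5 with h | h
  · have : t = 0 := by simpa using h
    simp [this]
  · linarith

theorem linearIndependent_a_b (h : IsWedgeConfig C c e a b u) :
    LinearIndependent ℝ ![a, b] := by
  rw [LinearIndependent.pair_iff]
  intro s t hst
  obtain ⟨x, y, hx, hy, rfl⟩ := h.exists_eq
  have h1 : (-(t * x)) • e + (s + t * y) • a = 0 := by rw [← hst]; module
  obtain ⟨h2, h3⟩ := LinearIndependent.pair_iff.1 h.linearIndependent_e_a _ _ h1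
  have ht : t = 0 := by
    rcases mul_eq_zero.1 (neg_eq_zero.1 h2) with h | h
    · exact h
    · exact absurd h hx.ne'
  subst ht
  simpa using h3

theorem isConeGauge_triangle (h : IsWedgeConfig C c e a b u) :
    IsConeGauge (cone e a) fun v => inner ℝ v e / ‖e‖ ^ 2 where
  zero_mem := zero_mem_cone e a
  smul_mem _ ht _ hv := smul_mem_cone hv ht
  map_smul t ht v := by rw [inner_smul_left, mul_div_assoc]; simp
  eq_zero := by
    rintro _ ⟨p, q, hp, hq, rfl⟩ hle
    have he := h.norm_e_pos
    rw [h.inner_add_e, mul_div_assoc, div_self (by positivity), mul_one] at hle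
    have hp0 : p = 0 := by linarith
    have hq0 : q = 0 := by linarith
    simp [hp0, hq0]

/-- Homogeneous form of the fact that the triangle lies in the disc of radius `‖a‖`; this is what
places `cutCore` inside the ball. -/
theorem norm_le_of_mem_cone (h : IsWedgeConfig C c e a b u) {v : V} (hv : v ∈ cone e a) :
    ‖v‖ ≤ ‖a‖ * (inner ℝ v e / ‖e‖ ^ 2) := by
  obtain ⟨p, q, hp, hq, rfl⟩ := hv
  have he := h.norm_e_pos
  rw [h.inner_add_e, mul_div_assoc, div_self (by positivity), mul_one]
  calc ‖p • e + q • a‖ ≤ ‖p • e‖ + ‖q • a‖ := norm_add_le _ _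
    _ = p * ‖e‖ + q * ‖a‖ := by
      rw [norm_smul, norm_smul, Real.norm_of_nonneg hp, Real.norm_of_nonneg hq]
    _ ≤ p * ‖a‖ + q * ‖a‖ := by gcongr; exact h.norm_e_lt.le
    _ = ‖a‖ * (p + q) := by ring

/-- Writing the domain as cone ∩ half-space ∩ disc makes its convexity and boundedness evident. -/
theorem union_eq (h : IsWedgeConfig C c e a b u) :
    triangleSet e a ∪ sectorSet a b =
      cone e b ∩ {v | inner ℝ v e ≤ ‖e‖ ^ 2} ∩ Metric.closedBall 0 ‖a‖ := by
  have he := h.norm_e_pos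
  have ha := h.norm_a_pos
  have he2 : 0 < ‖e‖ ^ 2 := by positivity
  have hlt := h.norm_sq_lt
  obtain ⟨x, y, hx, hy, hb⟩ := h.exists_eq
  ext v
  simp only [triangleSet, sectorSet, Set.mem_union, Set.mem_inter_iff, Set.mem_ofPred_eq,
    mem_closedBall_zero_iff, div_le_one he2, div_le_one ha]
  constructor
  · rintro (⟨hv, hle⟩ | ⟨hv, hle⟩)
    · have hn := h.norm_le_of_mem_cone hv
      obtain ⟨p, q, hp, hq, rfl⟩ := hv
      refine ⟨⟨⟨p + q * x / y, q / y, by positivity, by positivity, ?_⟩, hle⟩, ?_⟩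
      · rw [hb]
        match_scalars <;> field_simp
        ring
      · exact hn.trans (mul_le_of_le_one_right ha.le ((div_le_one he2).2 hle))
    · obtain ⟨p, q, hp, hq, rfl⟩ := hv
      refine ⟨⟨⟨p * x / y, q + p / y, by positivity, by positivity, ?_⟩, ?_⟩, hle⟩
      · rw [hb]
        match_scalars <;> field_simp <;> ring
      · have hv : p • a + q • b = (-(q * x)) • e + (p + q * y) • a := by rw [hb]; module
        have hn := (sq_le_sq₀ (norm_nonneg _) (norm_nonneg _)).2 hle
        rw [hv, h.norm_sq_add] at hn
        rw [hv, h.inner_add_e]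
        have hβ : 0 ≤ q * x := by positivity
        generalize q * x = β at *
        generalize p + q * y = α at *
        -- The squared norm is `(α - β)² ‖e‖² + α² (‖a‖² - ‖e‖²)`. Beyond the line through `e` and
        -- `a` both squares exceed 1, so it would exceed `‖a‖²`.
        by_contra hcon
        have h1 : 1 < -β + α := by
          by_contra h2
          exact hcon (mul_le_of_le_one_left he2.le (not_lt.1 h2))
        have h3 : 1 < α ^ 2 := by nlinarith
        have h4 : 1 < (α - β) ^ 2 := by nlinarith
        nlinarith [mul_pos (sub_pos.2 h3) (sub_pos.2 hlt), mul_pos (sub_pos.2 h4) he2]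
  · rintro ⟨⟨⟨p, q, hp, hq, rfl⟩, hle⟩, hn⟩
    -- The sign of `p - q * x`, the coefficient of `e` in the basis `e, a`, tells on which side of
    -- the ray through `a` the point lies.
    rcases le_total (q * x) p with hpq | hpq
    · exact Or.inl ⟨⟨p - q * x, q * y, sub_nonneg.2 hpq, by positivity, by rw [hb]; module⟩, hle⟩
    · refine Or.inr ⟨⟨p * y / x, q - p / x, by positivity, ?_, ?_⟩, hn⟩
      · rwa [sub_nonneg, div_le_iff₀ hx]
      · rw [hb]
        match_scalars <;> field_simp <;> ring

theorem convex_union (h : IsWedgeConfig C c e a b u) :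
    Convex ℝ (triangleSet e a ∪ sectorSet a b) := by
  rw [h.union_eq]
  refine ((convex_cone e b).inter ?_).inter (convex_closedBall _ _)
  have : {v : V | inner ℝ v e ≤ ‖e‖ ^ 2} = {v | innerSL ℝ e v ≤ ‖e‖ ^ 2} := by
    ext v; simp [real_inner_comm]
  rw [this]
  exact convex_halfSpace_le (innerSL ℝ e).isLinear _

/-- The part of the wedge over the triangle. -/
def core (C : Set V) (c e a : V) : Set V := convexJoin ℝ C ((fun v => c + v) '' triangleSet e a)

/-- The part of the wedge over the circular sector. -/
def rim (C : Set V) (c a b : V) : Set V := convexJoin ℝ C ((fun v => c + v) '' sectorSet a b)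

end IsWedgeConfig

end

/-! ### Comparing the densities of core and rim -/

section

variable {V : Type*} [NormedAddCommGroup V] [InnerProductSpace ℝ V]

theorem norm_le_one_iff_starProjection (P : Submodule ℝ V) [P.HasOrthogonalProjection] (z : V) :
    ‖z‖ ≤ 1 ↔ ‖z - P.starProjection z‖ ≤ 1 ∧
      ‖P.starProjection z‖ ≤ √(1 - ‖z - P.starProjection z‖ ^ 2) := by
  have h0 : inner ℝ (P.starProjection z) (z - P.starProjection z) = 0 :=
    P.sub_starProjection_mem_orthogonal z _ (P.starProjection_apply_mem z)
  have h : ‖z‖ ^ 2 = ‖P.starProjection z‖ ^ 2 + ‖z - P.starProjection z‖ ^ 2 := by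
    have := norm_add_sq_real (P.starProjection z) (z - P.starProjection z)
    rwa [h0, add_sub_cancel, mul_zero, add_zero] at this
  have h1 : ‖z‖ ≤ 1 ↔ ‖z‖ ^ 2 ≤ 1 := by
    rw [← sq_le_sq₀ (norm_nonneg z) zero_le_one, one_pow]
  have h2 : ‖z - P.starProjection z‖ ≤ 1 ↔ ‖z - P.starProjection z‖ ^ 2 ≤ 1 := by
    rw [← sq_le_sq₀ (norm_nonneg _) zero_le_one, one_pow]
  rw [h1, h2, h]
  constructor
  · intro hle
    refine ⟨by linarith [sq_nonneg ‖P.starProjection z‖], Real.le_sqrt_of_sq_le (by linarith)⟩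
  · rintro ⟨h3, h4⟩
    have := (Real.le_sqrt (norm_nonneg _) (by linarith)).1 h4
    linarith

namespace IsWedgeConfig

variable {C : Set V} {c e a b u : V}

theorem mem_orthogonal_span {z : V} (h1 : inner ℝ z e = 0) (h2 : inner ℝ z a = 0) :
    z ∈ (Submodule.span ℝ {e, a})ᗮ := by
  rw [Submodule.mem_orthogonal']
  intro v hv
  obtain ⟨p, q, rfl⟩ := Submodule.mem_span_pair.1 hv
  rw [inner_add_right, inner_smul_right, inner_smul_right, h1, h2]
  simp

theorem a_mem_span : a ∈ Submodule.span ℝ {e, a} := Submodule.subset_span (by simp)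

theorem e_mem_span : e ∈ Submodule.span ℝ {e, a} := Submodule.subset_span (by simp)

theorem b_mem_span (h : IsWedgeConfig C c e a b u) : b ∈ Submodule.span ℝ {e, a} := by
  obtain ⟨x, y, -, -, rfl⟩ := h.exists_eq
  exact sub_mem (Submodule.smul_mem _ _ a_mem_span) (Submodule.smul_mem _ _ e_mem_span)

theorem inner_nonneg (h : IsWedgeConfig C c e a b u) {y : V} (hy : y ∈ convexJoin ℝ C {c}) :
    0 ≤ inner ℝ y u := by
  obtain ⟨x, hx, s, t, -, ht, -, rfl⟩ : ∃ x ∈ C, y ∈ segment ℝ x c := by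
    simpa [mem_convexJoin] using hy
  rw [inner_add_left, inner_smul_left, inner_smul_left, h.inner_base_u x hx, h.inner_apex_u]
  simpa using ht

/-- The height function that describes the intersection of `rim` with the unit ball. -/
def cutHeight (a u y : V) : ℝ := min (inner ℝ y u) (√(1 - ‖y‖ ^ 2) / ‖a‖)

theorem continuous_cutHeight (a u : V) : Continuous (cutHeight a u) := by
  unfold cutHeight
  fun_prop

theorem convex_triangleSet (e a : V) : Convex ℝ (triangleSet e a) := by
  have h : {v : V | inner ℝ v e / ‖e‖ ^ 2 ≤ 1} = {v | ((‖e‖ ^ 2)⁻¹ • innerSL ℝ e) v ≤ 1} := by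
    ext v; simp [real_inner_comm, div_eq_inv_mul]
  have h' : Convex ℝ {v : V | inner ℝ v e / ‖e‖ ^ 2 ≤ 1} := by
    rw [h]
    exact convex_halfSpace_le ((‖e‖ ^ 2)⁻¹ • innerSL ℝ e).isLinear _
  exact (convex_cone e a).inter h'

theorem convex_core (h : IsWedgeConfig C c e a b u) : Convex ℝ (core C c e a) :=
  h.convex.convexJoin ((convex_triangleSet e a).translate c)

theorem e_mem_triangleSet (h : IsWedgeConfig C c e a b u) : e ∈ triangleSet e a := by
  refine ⟨⟨1, 0, by simp, by simp, by simp⟩, ?_⟩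
  have := h.norm_e_pos
  rw [real_inner_self_eq_norm_sq, div_self (by positivity)]

theorem subset_core (h : IsWedgeConfig C c e a b u) : C ⊆ core C c e a :=
  subset_convexJoin_left ⟨_, _, h.e_mem_triangleSet, rfl⟩

theorem isBounded_union (h : IsWedgeConfig C c e a b u) :
    Bornology.IsBounded (core C c e a ∪ rim C c a b) := by
  have hD : Bornology.IsBounded (triangleSet e a ∪ sectorSet a b) := by
    rw [h.union_eq]
    exact Metric.isBounded_closedBall.subset Set.inter_subset_right
  have hD' : Bornology.IsBounded ((fun v => c + v) '' (triangleSet e a ∪ sectorSet a b)) := by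
    have := hD.vadd c
    exact this
  rw [core, rim, ← convexJoin_union_right, ← Set.image_union]
  exact (isBounded_convexHull.2 (h.isCompact.isBounded.union hD')).subset
    (convexJoin_subset_convexHull _ _)

theorem isCompact_apex_join (h : IsWedgeConfig C c e a b u) : IsCompact (convexJoin ℝ C {c}) := by
  have himg : convexJoin ℝ C {c} =
      (fun p : V × ℝ => (1 - p.2) • p.1 + p.2 • c) '' (C ×ˢ Set.Icc 0 1) := by
    ext z
    simp only [convexJoin_singleton_right, Set.mem_iUnion, exists_prop, segment_eq_image,
      Set.mem_image, Set.mem_prod, Prod.exists]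
    grind
  rw [himg]
  exact (h.isCompact.prod isCompact_Icc).image (by fun_prop)

variable [FiniteDimensional ℝ V]

theorem core_eq (h : IsWedgeConfig C c e a b u) :
    core C c e a = sliceSet (Submodule.span ℝ {e, a}) (convexJoin ℝ C {c}) (cone e a)
      (fun v => inner ℝ v e / ‖e‖ ^ 2) fun y => inner ℝ y u :=
  convexJoin_eq_sliceSet h.isConeGauge_triangle (cone_subset e_mem_span a_mem_span)
    (fun z hz => mem_orthogonal_span (h.inner_base_e z hz) (h.inner_base_a z hz))
    (mem_orthogonal_span h.inner_apex_e h.inner_apex_a) h.inner_base_u h.inner_apex_u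

theorem rim_eq (h : IsWedgeConfig C c e a b u) :
    rim C c a b = sliceSet (Submodule.span ℝ {e, a}) (convexJoin ℝ C {c}) (cone a b)
      (fun v => ‖v‖ / ‖a‖) fun y => inner ℝ y u :=
  convexJoin_eq_sliceSet (isConeGauge_norm a b h.norm_a_pos)
    (cone_subset a_mem_span h.b_mem_span)
    (fun z hz => mem_orthogonal_span (h.inner_base_e z hz) (h.inner_base_a z hz))
    (mem_orthogonal_span h.inner_apex_e h.inner_apex_a) h.inner_base_u h.inner_apex_u

/-- The part of the unit ball in `core` that is cut out by the heights of the unit ball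
in `rim`. -/
def cutCore (C : Set V) (c e a u : V) : Set V :=
  sliceSet (Submodule.span ℝ {e, a}) (convexJoin ℝ C {c} ∩ Metric.closedBall 0 1) (cone e a)
    (fun v => inner ℝ v e / ‖e‖ ^ 2) (cutHeight a u)

/-- Over the sector the gauge is a multiple of the norm, so by Pythagoras intersecting with the ball
merely caps the height. -/
theorem rim_inter_closedBall_eq (h : IsWedgeConfig C c e a b u) :
    rim C c a b ∩ Metric.closedBall 0 1 =
      sliceSet (Submodule.span ℝ {e, a}) (convexJoin ℝ C {c} ∩ Metric.closedBall 0 1) (cone a b)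
        (fun v => ‖v‖ / ‖a‖) (cutHeight a u) := by
  rw [h.rim_eq]
  ext z
  simp only [sliceSet, cutHeight, Set.mem_inter_iff, Set.mem_ofPred_eq, mem_closedBall_zero_iff,
    le_min_iff, div_le_div_iff_of_pos_right h.norm_a_pos,
    norm_le_one_iff_starProjection (Submodule.span ℝ {e, a}) z]
  tauto

theorem cutCore_subset (h : IsWedgeConfig C c e a b u) :
    cutCore C c e a u ⊆ core C c e a ∩ Metric.closedBall 0 1 := by
  rw [h.core_eq]
  rintro z ⟨⟨hX, hB⟩, hK, hle⟩
  obtain ⟨h1, h2⟩ := le_min_iff.1 hle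
  refine ⟨⟨hX, hK, h1⟩, ?_⟩
  rw [mem_closedBall_zero_iff,
    norm_le_one_iff_starProjection (Submodule.span ℝ {e, a}) z]
  refine ⟨mem_closedBall_zero_iff.1 hB, (h.norm_le_of_mem_cone hK).trans ?_⟩
  calc _ ≤ ‖a‖ * _ := mul_le_mul_of_nonneg_left h2 h.norm_a_pos.le
    _ = _ := mul_div_cancel₀ _ h.norm_a_pos.ne'

variable [MeasurableSpace V] [BorelSpace V]

/-- Near the point of the unit sphere in direction `c + e`, the unit ball in `core` is not
exhausted by `cutCore`. -/
theorem volume_cutCore_lt (h : IsWedgeConfig C c e a b u) (hpos : 0 < volume (core C c e a)) :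
    volume (cutCore C c e a u) < volume (core C c e a ∩ Metric.closedBall 0 1) := by
  set P := Submodule.span ℝ {e, a} with hP
  set U : Set V := {z | √(1 - ‖z - P.starProjection z‖ ^ 2) / ‖a‖ <
    inner ℝ (P.starProjection z) e / ‖e‖ ^ 2} with hUdef
  have hU : IsOpen U := by
    have h1 : Continuous fun z => P.starProjection z := P.starProjection.continuous
    exact isOpen_lt (by fun_prop) (by fun_prop)
  have hconv : Convex ℝ (core C c e a ∩ Metric.closedBall 0 1) :=
    h.convex_core.inter (convex_closedBall _ _)
  -- A convex set with empty interior is contained in its own frontier, which is null.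
  have hint : (interior (core C c e a)).Nonempty := by
    rw [Set.nonempty_iff_ne_empty]
    intro hemp
    have h1 := h.convex_core.addHaar_frontier volume
    have h2 : core C c e a ⊆ frontier (core C c e a) := by
      rw [frontier, hemp, Set.sdiff_empty]
      exact subset_closure
    exact hpos.ne' (measure_mono_null h2 h1)
  -- The origin belongs to the core, hence is a limit of interior points, some of which lie in the
  -- open unit ball.
  have hint2 : (interior (core C c e a ∩ Metric.closedBall 0 1)).Nonempty := by
    have h0 : (0 : V) ∈ closure (interior (core C c e a)) := by
      rw [h.convex_core.closure_interior_eq_closure_of_nonempty_interior hint]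
      exact subset_closure (h.subset_core h.zero_mem)
    obtain ⟨z, hz, hz'⟩ := mem_closure_iff.1 h0 (Metric.ball 0 1) Metric.isOpen_ball (by simp)
    refine ⟨z, ?_⟩
    rw [interior_inter]
    exact ⟨hz', Metric.ball_subset_interior_closedBall hz⟩
  have hne : (U ∩ interior (core C c e a ∩ Metric.closedBall 0 1)).Nonempty := by
    -- At `k • (c + e)`, on the unit sphere, the gauge of the planar component is `k`, while the cap
    -- is `k * ‖e‖ / ‖a‖ < k`. The bound `1 ≤ ‖c + e‖` keeps this point in the core.
    set k := ‖c + e‖⁻¹ with hk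
    have hk0 : 0 < k := inv_pos.2 (one_pos.trans_le h.one_le_norm)
    have hk1 : k ≤ 1 := inv_le_one_of_one_le₀ h.one_le_norm
    have hnorm : ‖k • (c + e)‖ = 1 := by
      rw [norm_smul, Real.norm_of_nonneg hk0.le, hk,
        inv_mul_cancel₀ (one_pos.trans_le h.one_le_norm).ne']
    have hmem : k • (c + e) ∈ core C c e a ∩ Metric.closedBall 0 1 := by
      refine ⟨?_, by rw [mem_closedBall_zero_iff, hnorm]⟩
      have h1 : c + e ∈ core C c e a :=
        subset_convexJoin_right ⟨0, h.zero_mem⟩ ⟨e, h.e_mem_triangleSet, rfl⟩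
      exact h.convex_core.smul_mem_of_zero_mem (h.subset_core h.zero_mem) h1 ⟨hk0.le, hk1⟩
    -- The point may lie on the boundary, but it is a limit of interior points, and `U` is an open
    -- neighbourhood of it.
    have hcl := subset_closure hmem
    rw [← hconv.closure_interior_eq_closure_of_nonempty_interior hint2] at hcl
    refine mem_closure_iff.1 hcl U hU ?_
    have hproj : P.starProjection (k • (c + e)) = k • e := by
      rw [map_smul, map_add, (Submodule.starProjection_apply_eq_zero_iff P).2
        (mem_orthogonal_span h.inner_apex_e h.inner_apex_a),
        Submodule.starProjection_eq_self_iff.2 e_mem_span, zero_add]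
    have hsub : k • (c + e) - k • e = k • c := by module
    have hsq : 1 - ‖k • c‖ ^ 2 = (k * ‖e‖) ^ 2 := by
      have : ‖c + e‖ ^ 2 = ‖c‖ ^ 2 + ‖e‖ ^ 2 := by
        rw [norm_add_sq_real, h.inner_apex_e]; ring
      rw [norm_smul, Real.norm_of_nonneg hk0.le] at hnorm ⊢
      have h1 : (k * ‖c + e‖) ^ 2 = 1 := by rw [hnorm]; norm_num
      rw [mul_pow, this] at h1
      rw [mul_pow, mul_pow]
      linarith
    have he := h.norm_e_pos
    rw [hUdef, Set.mem_ofPred_eq, hproj, hsub, hsq, Real.sqrt_sq (by positivity),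
      inner_smul_left, real_inner_self_eq_norm_sq, mul_div_assoc, mul_div_assoc,
      div_self (by positivity), conj_trivial]
    exact mul_lt_mul_of_pos_left ((div_lt_one h.norm_a_pos).2 h.norm_e_lt) hk0
  have hopen := (hU.inter isOpen_interior).measure_pos volume hne
  have hdisj : Disjoint (cutCore C c e a u)
      (U ∩ interior (core C c e a ∩ Metric.closedBall 0 1)) := by
    rw [Set.disjoint_left]
    rintro z ⟨-, -, hle⟩ ⟨hz, -⟩
    exact absurd (hle.trans (min_le_right _ _)) (not_le.2 hz)
  have hfin : volume (core C c e a ∩ Metric.closedBall 0 1) ≠ ⊤ :=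
    ((measure_mono Set.inter_subset_right).trans_lt measure_closedBall_lt_top).ne
  have hle : volume (cutCore C c e a u) +
      volume (U ∩ interior (core C c e a ∩ Metric.closedBall 0 1)) ≤
      volume (core C c e a ∩ Metric.closedBall 0 1) := by
    rw [← measure_union hdisj (hU.inter isOpen_interior).measurableSet]
    exact measure_mono (Set.union_subset h.cutCore_subset
      (Set.inter_subset_right.trans interior_subset))
  refine lt_of_lt_of_le ?_ hle
  exact ENNReal.lt_add_right (ne_top_of_le_ne_top hfin (measure_mono h.cutCore_subset)) hopen.ne'

/-- Each of the four volumes is one of two shape areas times one of two height integrals, and both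
products contain all four factors. -/
theorem volume_core_mul (h : IsWedgeConfig C c e a b u) :
    volume (cutCore C c e a u) * volume (rim C c a b) =
      volume (rim C c a b ∩ Metric.closedBall 0 1) * volume (core C c e a) := by
  have hX := h.isCompact_apex_join.isClosed.measurableSet
  have hXB := hX.inter (measurableSet_closedBall (x := (0 : V)) (ε := 1))
  have hK1 := (isClosed_cone h.linearIndependent_e_a).measurableSet
  have hK2 := (isClosed_cone h.linearIndependent_a_b).measurableSet
  have hf : Continuous fun y : V => (inner ℝ y u : ℝ) := by fun_prop
  have hf' := continuous_cutHeight a u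
  have hφ : Continuous fun v : V => (inner ℝ v e : ℝ) / ‖e‖ ^ 2 := by fun_prop
  have hψ : Continuous fun v : V => ‖v‖ / ‖a‖ := by fun_prop
  have h0 : ∀ y ∈ convexJoin ℝ C {c}, 0 ≤ (inner ℝ y u : ℝ) := fun y hy => h.inner_nonneg hy
  have h0' : ∀ y ∈ convexJoin ℝ C {c} ∩ Metric.closedBall 0 1, 0 ≤ cutHeight a u y :=
    fun y hy => le_min (h0 y hy.1) (by positivity)
  have g1 := h.isConeGauge_triangle
  have g2 := isConeGauge_norm a b h.norm_a_pos
  rw [h.rim_inter_closedBall_eq, h.rim_eq, h.core_eq, cutCore,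
    volume_sliceSet _ hXB hK1 hφ hf' g1 h0', volume_sliceSet _ hX hK2 hψ hf g2 h0,
    volume_sliceSet _ hXB hK2 hψ hf' g2 h0', volume_sliceSet _ hX hK1 hφ hf g1 h0]
  ring

/-- Core and rim share the height integral, which is nonzero because the core has positive volume;
only the sector's area remains to be checked. -/
theorem volume_rim_pos (h : IsWedgeConfig C c e a b u) (hpos : 0 < volume (core C c e a)) :
    0 < volume (rim C c a b) := by
  have hX := h.isCompact_apex_join.isClosed.measurableSet
  have hK1 := (isClosed_cone h.linearIndependent_e_a).measurableSet
  have hK2 := (isClosed_cone h.linearIndependent_a_b).measurableSet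
  have hf : Continuous fun y : V => (inner ℝ y u : ℝ) := by fun_prop
  rw [h.core_eq, volume_sliceSet _ hX hK1 (by fun_prop) hf h.isConeGauge_triangle
    fun y hy => h.inner_nonneg hy] at hpos
  rw [h.rim_eq, volume_sliceSet _ hX hK2 (by fun_prop) hf (isConeGauge_norm a b h.norm_a_pos)
    fun y hy => h.inner_nonneg hy]
  refine ENNReal.mul_pos (ne_of_gt ?_) (right_ne_zero_of_mul hpos.ne')
  refine volume_sector_pos a_mem_span h.b_mem_span (fun v hv => ?_) h.norm_a_pos
  obtain ⟨p, q, rfl⟩ := Submodule.mem_span_pair.1 hv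
  obtain ⟨x, y, hx, hy, hb⟩ := h.exists_eq
  refine ⟨q + p * y / x, -(p / x), ?_⟩
  rw [hb]
  match_scalars <;> field_simp
  ring

/-- The hyperplane orthogonal to the component `n` of `e` perpendicular to `a` separates the two
parts: `n` is nonnegative on the core and nonpositive on the rim. -/
theorem aedisjoint_core_rim (h : IsWedgeConfig C c e a b u) :
    AEDisjoint volume (core C c e a) (rim C c a b) := by
  obtain ⟨x, y, hx, hy, hb⟩ := h.exists_eq
  set n : V := e - (‖e‖ ^ 2 / ‖a‖ ^ 2) • a with hn
  have ha := h.norm_a_pos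
  have he := h.norm_e_pos
  have hna : inner ℝ n a = 0 := by
    rw [hn, inner_sub_left, inner_smul_left, h.inner_e_a, real_inner_self_eq_norm_sq, conj_trivial]
    field_simp
    ring
  have hne : 0 < inner ℝ n e := by
    rw [hn, inner_sub_left, inner_smul_left, real_inner_comm e a, h.inner_e_a,
      real_inner_self_eq_norm_sq, conj_trivial, sub_pos, div_mul_eq_mul_div,
      div_lt_iff₀ (by positivity)]
    exact mul_lt_mul_of_pos_left h.norm_sq_lt (by positivity)
  have hbase : ∀ z : V, inner ℝ z e = 0 → inner ℝ z a = 0 → inner ℝ n z = 0 := by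
    intro z h1 h2
    rw [hn, inner_sub_left, inner_smul_left, real_inner_comm, h1, real_inner_comm, h2]
    simp
  have hc := hbase c h.inner_apex_e h.inner_apex_a
  have hker : volume ((ℝ ∙ n)ᗮ : Set V) = 0 := by
    refine Measure.addHaar_submodule _ _ fun htop => ?_
    have : e ∈ (ℝ ∙ n)ᗮ := by rw [htop]; trivial
    rw [Submodule.mem_orthogonal_singleton_iff_inner_right] at this
    exact hne.ne' this
  refine measure_mono_null ?_ hker
  rintro z ⟨h1, h2⟩
  rw [SetLike.mem_coe, Submodule.mem_orthogonal_singleton_iff_inner_right]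
  apply le_antisymm
  · obtain ⟨x', hx', _, ⟨_, ⟨⟨p, q, hp, hq, rfl⟩, -⟩, rfl⟩, s, t, hs, ht, -, rfl⟩ :=
      mem_convexJoin.1 h2
    simp only [inner_add_right, inner_smul_right, hc, hna,
      hbase x' (h.inner_base_e _ hx') (h.inner_base_a _ hx'), hb, inner_sub_right]
    have : 0 ≤ t * (q * (x * inner ℝ n e)) := by positivity
    linarith
  · obtain ⟨x', hx', _, ⟨_, ⟨⟨p, q, hp, hq, rfl⟩, -⟩, rfl⟩, s, t, hs, ht, -, rfl⟩ :=
      mem_convexJoin.1 h1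
    simp only [inner_add_right, inner_smul_right, hc, hna,
      hbase x' (h.inner_base_e _ hx') (h.inner_base_a _ hx')]
    have : 0 ≤ t * (p * inner ℝ n e) := by positivity
    linarith

theorem measurableSet_rim (h : IsWedgeConfig C c e a b u) : MeasurableSet (rim C c a b) := by
  rw [h.rim_eq]
  exact measurableSet_sliceSet _ h.isCompact_apex_join.isClosed.measurableSet
    (isClosed_cone h.linearIndependent_a_b).measurableSet (by fun_prop) (by fun_prop)

/-- A mediant argument: the density of the union is a weighted average of those of core and rim, and
the latter equals the fraction of the core filled by `cutCore`. -/
theorem density_lt (h : IsWedgeConfig C c e a b u) (hpos : 0 < volume (core C c e a)) :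
    volume.real ((core C c e a ∪ rim C c a b) ∩ Metric.closedBall 0 1) /
        volume.real (core C c e a ∪ rim C c a b) <
      volume.real (core C c e a ∩ Metric.closedBall 0 1) / volume.real (core C c e a) := by
  have hfin := h.isBounded_union.measure_lt_top (μ := volume)
  have hfc : volume (core C c e a) ≠ ⊤ :=
    ((measure_mono Set.subset_union_left).trans_lt hfin).ne
  have hfr : volume (rim C c a b) ≠ ⊤ :=
    ((measure_mono Set.subset_union_right).trans_lt hfin).ne
  have hfB : ∀ s : Set V, volume (s ∩ Metric.closedBall 0 1) ≠ ⊤ := fun s =>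
    ((measure_mono Set.inter_subset_right).trans_lt measure_closedBall_lt_top).ne
  have h1 : volume.real (core C c e a ∪ rim C c a b) =
      volume.real (core C c e a) + volume.real (rim C c a b) := by
    unfold Measure.real
    rw [measure_union₀ h.measurableSet_rim.nullMeasurableSet h.aedisjoint_core_rim,
      ENNReal.toReal_add hfc hfr]
  have h2 : volume.real ((core C c e a ∪ rim C c a b) ∩ Metric.closedBall 0 1) ≤
      volume.real (core C c e a ∩ Metric.closedBall 0 1) +
        volume.real (rim C c a b ∩ Metric.closedBall 0 1) := by
    rw [Set.union_inter_distrib_right]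
    exact measureReal_union_le _ _
  have h3 : volume.real (cutCore C c e a u) * volume.real (rim C c a b) =
      volume.real (rim C c a b ∩ Metric.closedBall 0 1) * volume.real (core C c e a) := by
    unfold Measure.real
    rw [← ENNReal.toReal_mul, ← ENNReal.toReal_mul, h.volume_core_mul]
  have h4 : volume.real (cutCore C c e a u) <
      volume.real (core C c e a ∩ Metric.closedBall 0 1) :=
    ENNReal.toReal_strict_mono (hfB _) (h.volume_cutCore_lt hpos)
  have h5 : 0 < volume.real (core C c e a) := ENNReal.toReal_pos hpos.ne' hfc
  have h6 : 0 < volume.real (rim C c a b) := ENNReal.toReal_pos (h.volume_rim_pos hpos).ne' hfr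
  rw [h1, div_lt_div_iff₀ (by positivity) h5]
  have h7 := mul_lt_mul_of_pos_right h4 h6
  have h8 := mul_le_mul_of_nonneg_right h2 h5.le
  linarith

end IsWedgeConfig

end

/-! ### From the wedge frame to the abstract configuration -/

section

variable {d n : ℕ}

theorem IsWedgeConfig.convexHull_triple {c e a u b : E d} {C : Set (E d)}
    (h : IsWedgeConfig C c e a b u) :
    convexHull ℝ {c, c + e, c + a} = (fun v => c + v) '' triangleSet e a := by
  have he := h.norm_e_pos
  apply Set.Subset.antisymm
  · refine convexHull_min ?_ ((IsWedgeConfig.convex_triangleSet e a).translate c)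
    rintro _ (rfl | rfl | rfl)
    · exact ⟨0, ⟨zero_mem_cone e a, by simp⟩, by simp⟩
    · exact ⟨e, h.e_mem_triangleSet, rfl⟩
    · refine ⟨a, ⟨⟨0, 1, by simp, by simp, by simp⟩, ?_⟩, rfl⟩
      rw [real_inner_comm, h.inner_e_a, div_self (by positivity)]
  · rintro _ ⟨_, ⟨⟨p, q, hp, hq, rfl⟩, hle⟩, rfl⟩
    rw [h.inner_add_e, mul_div_assoc, div_self (by positivity), mul_one] at hle
    have hmem : ∀ x ∈ ({c, c + e, c + a} : Set (E d)),
        x ∈ convexHull ℝ {c, c + e, c + a} := fun x hx => subset_convexHull _ _ hx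
    have := (convex_convexHull ℝ {c, c + e, c + a}).sum_mem (t := Finset.univ)
      (w := ![1 - p - q, p, q]) (z := ![c, c + e, c + a])
      (by intro i _; fin_cases i <;> simp <;> linarith)
      (by simp only [Fin.sum_univ_three, Matrix.cons_val]; ring)
      (by intro i _; fin_cases i <;> exact hmem _ (by simp))
    convert this using 1
    simp only [Fin.sum_univ_three, Matrix.cons_val]
    module

namespace IsWedgeFrame

theorem norm_sq_eq {w : ℕ → E d} (hw : IsWedgeFrame w) {i : ℕ} (hi : 1 ≤ i) (hd : i ≤ d) :
    ‖w i‖ ^ 2 = 2 * (i : ℝ) / ((i : ℝ) + 1) := by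
  rw [hw.norm_eq i hi hd, Real.sq_sqrt (by positivity)]

theorem inner_eq {w : ℕ → E d} (hw : IsWedgeFrame w) {i j : ℕ} (hi : 1 ≤ i) (hij : i ≤ j)
    (hd : j ≤ d) : inner ℝ (w i) (w j) = 2 * (i : ℝ) / ((i : ℝ) + 1) := by
  rw [← hw.norm_sq_eq hi (hij.trans hd)]
  rcases hij.eq_or_lt with rfl | hlt
  · exact real_inner_self_eq_norm_sq _
  · have := hw.orthogonal i j hi hlt hd
    rw [inner_sub_right, real_inner_self_eq_norm_sq] at this
    linarith

theorem inner_sub_eq_zero {w : ℕ → E d} (hw : IsWedgeFrame w) {i j k : ℕ} (hi : 1 ≤ i)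
    (hij : i ≤ j) (hjk : j ≤ k) (hd : k ≤ d) : inner ℝ (w i) (w k - w j) = 0 := by
  rw [inner_sub_right, hw.inner_eq hi hij (hjk.trans hd), hw.inner_eq hi (hij.trans hjk) hd,
    sub_self]

/-- The frame leaves `w 0` unconstrained, so it is reset to the origin, the remaining vertex of the
orthoscheme. -/
theorem isRogersOrthoscheme {w : ℕ → E d} (hw : IsWedgeFrame w) :
    IsRogersOrthoscheme (Function.update w 0 0) where
  inner_eq i j hij hj := by
    rcases Nat.eq_zero_or_pos i with rfl | hi
    · simp
    · rw [Function.update_of_ne (by omega), Function.update_of_ne (by omega),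
        hw.inner_eq hi hij hj]

theorem image_update_Iic (w : ℕ → E d) (m : ℕ) :
    Function.update w 0 0 '' Set.Iic m = {0} ∪ w '' Set.Icc 1 m := by
  ext x
  simp only [Set.mem_image, Set.mem_Iic, Set.mem_union, Set.mem_singleton_iff, Set.mem_Icc]
  constructor
  · rintro ⟨k, hk, rfl⟩
    rcases Nat.eq_zero_or_pos k with rfl | hk0
    · simp
    · exact Or.inr ⟨k, ⟨hk0, hk⟩, by rw [Function.update_of_ne (by omega)]⟩
  · rintro (rfl | ⟨k, ⟨hk0, hk⟩, rfl⟩)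
    · exact ⟨0, Nat.zero_le _, by simp⟩
    · exact ⟨k, hk, by rw [Function.update_of_ne (by omega)]⟩

/-- The base of the wedge. -/
def base (w : ℕ → E (n + 3)) : Set (E (n + 3)) := convexHull ℝ ({0} ∪ w '' Set.Icc 1 n)

theorem inner_base {w : ℕ → E (n + 3)} {z : E (n + 3)}
    (h : ∀ i, 1 ≤ i → i ≤ n → inner ℝ (w i) z = 0) : ∀ x ∈ base w, inner ℝ x z = 0 := by
  have hsub : base w ⊆ ((ℝ ∙ z)ᗮ : Submodule ℝ (E (n + 3))) := by
    refine convexHull_min ?_ (Submodule.convex _)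
    rintro _ (rfl | ⟨i, ⟨hi, hin⟩, rfl⟩)
    · exact zero_mem _
    · rw [SetLike.mem_coe, Submodule.mem_orthogonal_singleton_iff_inner_left]
      exact h i hi hin
  intro x hx
  exact (Submodule.mem_orthogonal_singleton_iff_inner_left).1 (hsub hx)

/-- Separation by the line gives the expression with `x > 0`. Of the angle condition only acuteness
is needed, to force `y > 0`. -/
theorem exists_eq_sub {w : ℕ → E (n + 3)} (hw : IsWedgeFrame w)
    (hea : 0 ≤ (inner ℝ (w (n + 3) - w (n + 1)) (w (n + 2) - w (n + 1)) : ℝ)) :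
    ∃ x y : ℝ, 0 < x ∧ 0 < y ∧
      w (n + 4) - w (n + 1) = y • (w (n + 3) - w (n + 1)) - x • (w (n + 2) - w (n + 1)) := by
  have hopp := hw.opposite
  have hangle := hw.angle_eq
  simp only [show n + 3 - 2 = n + 1 from rfl, show n + 3 - 1 = n + 2 from rfl,
    show n + 3 + 1 = n + 4 from rfl] at hopp hangle
  set c := w (n + 1)
  rw [AffineSubspace.sOppSide_iff_exists_left (left_mem_affineSpan_pair ℝ c (w (n + 3)))] at hopp
  obtain ⟨hne1, hne2, p, hp, hray⟩ := hopp
  obtain ⟨y, rfl⟩ := mem_affineSpan_pair_iff_exists_lineMap_eq.1 hp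
  have h1 : w (n + 2) -ᵥ c ≠ 0 := by
    rw [vsub_ne_zero]
    exact fun h => hne1 (h ▸ left_mem_affineSpan_pair ℝ c (w (n + 3)))
  have h2 : AffineMap.lineMap c (w (n + 3)) y -ᵥ w (n + 4) ≠ 0 := by
    rw [vsub_ne_zero]
    exact fun h => hne2 (h ▸ hp)
  obtain ⟨r, s, hr, hs, hrs⟩ := hray.exists_pos h1 h2
  have hb : w (n + 4) - c = y • (w (n + 3) - c) - (r / s) • (w (n + 2) - c) := by
    rw [AffineMap.lineMap_apply, vsub_eq_sub, vsub_eq_sub, vsub_eq_sub, vadd_eq_add] at hrs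
    have h3 : (r / s) • (w (n + 2) - c) = y • (w (n + 3) - c) + c - w (n + 4) := by
      rw [div_eq_inv_mul, mul_smul, hrs, inv_smul_smul₀ hs.ne']
    rw [h3]
    abel
  refine ⟨r / s, y, by positivity, ?_, hb⟩
  have hpos : 0 < (inner ℝ (w (n + 3) - c) (w (n + 4) - c) : ℝ) := by
    have h4 : EuclideanGeometry.angle (w (n + 3)) c (w (n + 4)) < Real.pi / 2 := by
      rw [hangle]
      linarith [EuclideanGeometry.angle_nonneg (w (n + 2)) c (w (n + 3)), Real.pi_pos]
    rw [EuclideanGeometry.angle, InnerProductGeometry.angle, Real.arccos_lt_pi_div_two] at h4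
    by_contra hneg
    exact absurd (div_nonpos_of_nonpos_of_nonneg (not_lt.1 hneg) (by positivity)) (not_le.2 h4)
  rw [hb, inner_sub_right, inner_smul_right, inner_smul_right, real_inner_self_eq_norm_sq] at hpos
  have h5 : 0 ≤ r / s * (inner ℝ (w (n + 3) - c) (w (n + 2) - c) : ℝ) := by positivity
  have h6 : 0 < y * ‖w (n + 3) - c‖ ^ 2 := by linarith
  exact pos_of_mul_pos_left h6 (sq_nonneg _)

/-- Everything but the position of `b` is read off the Gram matrix. The functional comes from `w (n
+ 1) - w n`, which is orthogonal to `w 1, …, w n`, normalised to be 1 at the apex. -/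
theorem isWedgeConfig {w : ℕ → E (n + 3)} (hw : IsWedgeFrame w) (hn : 1 ≤ n) :
    IsWedgeConfig (base w) (w (n + 1)) (w (n + 2) - w (n + 1)) (w (n + 3) - w (n + 1))
      (w (n + 4) - w (n + 1))
      ((inner ℝ (w (n + 1)) (w (n + 1) - w n) : ℝ)⁻¹ • (w (n + 1) - w n)) := by
  have g1 := hw.inner_eq (i := n + 1) (j := n + 1) (by omega) le_rfl (by omega)
  have g12 := hw.inner_eq (i := n + 1) (j := n + 2) (by omega) (by omega) (by omega)
  have g13 := hw.inner_eq (i := n + 1) (j := n + 3) (by omega) (by omega) (by omega)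
  have g2 := hw.inner_eq (i := n + 2) (j := n + 2) (by omega) (by omega) (by omega)
  have g23 := hw.inner_eq (i := n + 2) (j := n + 3) (by omega) (by omega) (by omega)
  have g3 := hw.inner_eq (i := n + 3) (j := n + 3) (by omega) (by omega) (by omega)
  have g01 := hw.inner_eq (i := n) (j := n + 1) hn (by omega) (by omega)
  -- Squared norms of consecutive frame vectors strictly increase, which yields all the strict
  -- length inequalities.
  have mono : ∀ k : ℕ, 2 * (k : ℝ) / (k + 1) < 2 * ((k + 1 : ℕ) : ℝ) / ((k + 1 : ℕ) + 1) := by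
    intro k
    rw [div_lt_div_iff₀ (by positivity) (by positivity)]
    push_cast
    nlinarith
  have m0 := mono n
  have m1 := mono (n + 1)
  have m2 := mono (n + 2)
  have hee : ‖w (n + 2) - w (n + 1)‖ ^ 2 = 2 * ((n + 2 : ℕ) : ℝ) / ((n + 2 : ℕ) + 1) -
      2 * ((n + 1 : ℕ) : ℝ) / ((n + 1 : ℕ) + 1) := by
    rw [← real_inner_self_eq_norm_sq, inner_sub_left, inner_sub_right, inner_sub_right,
      real_inner_comm (w (n + 1)) (w (n + 2)), g1, g12, g2]
    ring
  have hea : inner ℝ (w (n + 2) - w (n + 1)) (w (n + 3) - w (n + 1)) =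
      ‖w (n + 2) - w (n + 1)‖ ^ 2 := by
    rw [hee, inner_sub_left, inner_sub_right, inner_sub_right,
      real_inner_comm (w (n + 1)) (w (n + 2)), g1, g12, g13, g23]
    ring
  have haa : ‖w (n + 3) - w (n + 1)‖ ^ 2 = 2 * ((n + 3 : ℕ) : ℝ) / ((n + 3 : ℕ) + 1) -
      2 * ((n + 1 : ℕ) : ℝ) / ((n + 1 : ℕ) + 1) := by
    rw [← real_inner_self_eq_norm_sq, inner_sub_left, inner_sub_right, inner_sub_right,
      real_inner_comm (w (n + 1)) (w (n + 3)), g1, g13, g3]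
    ring
  have hcc : 0 < (inner ℝ (w (n + 1)) (w (n + 1) - w n) : ℝ) := by
    rw [inner_sub_right, real_inner_comm (w n), g1, g01]
    linarith
  refine ⟨?_, convex_convexHull ℝ _, subset_convexHull _ _ (by simp), ?_, ?_, ?_, ?_, ?_, ?_, hea,
    ?_, ?_, ?_, ?_, ?_⟩
  · exact ((Set.finite_singleton _).union ((Set.finite_Icc _ _).image _)).isCompact_convexHull ℝ
  · exact inner_base fun i hi hin => hw.inner_sub_eq_zero hi (by omega) (by omega) (by omega)
  · exact inner_base fun i hi hin => hw.inner_sub_eq_zero hi (by omega) (by omega) (by omega)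
  · refine inner_base fun i hi hin => ?_
    rw [inner_smul_right, hw.inner_sub_eq_zero hi (by omega) (by omega) (by omega), mul_zero]
  · exact hw.inner_sub_eq_zero (by omega) le_rfl (by omega) (by omega)
  · exact hw.inner_sub_eq_zero (by omega) le_rfl (by omega) (by omega)
  · rw [inner_smul_right, inv_mul_cancel₀ hcc.ne']
  · rw [← sq_lt_sq₀ le_rfl (norm_nonneg _), hee]
    linarith
  · rw [← sq_lt_sq₀ (norm_nonneg _) (norm_nonneg _), hee, haa]
    linarith
  · refine hw.exists_eq_sub ?_
    rw [real_inner_comm, hea]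
    positivity
  · have := hw.dist_eq
    rwa [dist_eq_norm, dist_eq_norm] at this
  · rw [add_sub_cancel, ← sq_le_sq₀ zero_le_one (norm_nonneg _), ← real_inner_self_eq_norm_sq, g2,
      le_div_iff₀ (by positivity)]
    push_cast
    linarith

theorem circularSector_eq {c a b : E d} :
    circularSector c (c + a) (c + b) = (fun v => c + v) '' {v | v ∈ cone a b ∧ ‖v‖ ≤ ‖a‖} := by
  ext x
  simp only [circularSector, cone, Set.mem_ofPred_eq, Set.mem_image, add_sub_cancel_left,
    dist_eq_norm]
  constructor
  · rintro ⟨hle, s, t, hs, ht, rfl⟩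
    refine ⟨s • a + t • b, ⟨⟨s, t, hs, ht, rfl⟩, ?_⟩, by abel⟩
    rwa [add_assoc, add_sub_cancel_left] at hle
  · rintro ⟨_, ⟨⟨s, t, hs, ht, rfl⟩, hle⟩, rfl⟩
    refine ⟨by simpa using hle, s, t, hs, ht, by abel⟩

theorem convexHull_triangle_eq {w : ℕ → E (n + 3)} (hw : IsWedgeFrame w) (hn : 1 ≤ n) :
    convexHull ℝ {w (n + 1), w (n + 2), w (n + 3)} = (fun v => w (n + 1) + v) ''
      triangleSet (w (n + 2) - w (n + 1)) (w (n + 3) - w (n + 1)) := by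
  rw [← (hw.isWedgeConfig hn).convexHull_triple, add_sub_cancel, add_sub_cancel]

/-- Since `D` is convex, the hull of its union with the base vertices is the join of the base with
`D`, and joins distribute over the union of triangle and sector. -/
theorem wedge_eq {w : ℕ → E (n + 3)} (hw : IsWedgeFrame w) (hn : 1 ≤ n) :
    wedge w = IsWedgeConfig.core (base w) (w (n + 1)) (w (n + 2) - w (n + 1))
        (w (n + 3) - w (n + 1)) ∪
      IsWedgeConfig.rim (base w) (w (n + 1)) (w (n + 3) - w (n + 1))
        (w (n + 4) - w (n + 1)) := by
  have h := hw.isWedgeConfig hn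
  have hD : wedgeDomain w = (fun v => w (n + 1) + v) ''
      (triangleSet (w (n + 2) - w (n + 1)) (w (n + 3) - w (n + 1)) ∪
        sectorSet (w (n + 3) - w (n + 1)) (w (n + 4) - w (n + 1))) := by
    have h2 := circularSector_eq (c := w (n + 1)) (a := w (n + 3) - w (n + 1))
      (b := w (n + 4) - w (n + 1))
    rw [add_sub_cancel, add_sub_cancel] at h2
    rw [Set.image_union, ← hw.convexHull_triangle_eq hn, wedgeDomain]
    congr 1
    simp only [sectorSet, div_le_one h.norm_a_pos]
    exact h2
  have hconv : Convex ℝ (wedgeDomain w) := by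
    rw [hD]
    exact h.convex_union.translate _
  have hne : (wedgeDomain w).Nonempty := by
    rw [hD]
    exact ⟨_, _, Or.inl h.e_mem_triangleSet, rfl⟩
  rw [wedge, convexHull_union ⟨0, by simp⟩ hne, hconv.convexHull_eq, hD, Set.image_union,
    convexJoin_union_right]
  rfl

theorem convexHull_eq_core {w : ℕ → E (n + 3)} (hw : IsWedgeFrame w) (hn : 1 ≤ n) :
    convexHull ℝ (Function.update w 0 0 '' Set.Iic (n + 3)) =
      IsWedgeConfig.core (base w) (w (n + 1)) (w (n + 2) - w (n + 1))
        (w (n + 3) - w (n + 1)) := by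
  have hset : ({0} ∪ w '' Set.Icc 1 (n + 3) : Set (E (n + 3))) =
      ({0} ∪ w '' Set.Icc 1 n) ∪ {w (n + 1), w (n + 2), w (n + 3)} := by
    have : Set.Icc 1 (n + 3) = Set.Icc 1 n ∪ {n + 1, n + 2, n + 3} := by
      ext k
      simp only [Set.mem_Icc, Set.mem_union, Set.mem_insert_iff, Set.mem_singleton_iff]
      omega
    rw [this, Set.image_union, Set.image_insert_eq, Set.image_pair, Set.union_assoc]
  rw [image_update_Iic, hset, convexHull_union ⟨0, by simp⟩ ⟨w (n + 1), by simp⟩,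
    hw.convexHull_triangle_eq hn]
  rfl

end IsWedgeFrame

end

end SpherePacking

end

theorem mainTheorem3 (d : ℕ) (hd : 8 ≤ d)
    (w : ℕ → SpherePacking.E d) (hw : SpherePacking.IsWedgeFrame w)
    (p : Fin (d + 1) → SpherePacking.E d) (hp : SpherePacking.IsRegularSimplexOfEdgeTwo p) :
    SpherePacking.wedgeDensity w < SpherePacking.simplexDensity p := by
  obtain ⟨n, rfl⟩ : ∃ n, d = n + 3 := ⟨d - 3, by omega⟩
  have hn : 1 ≤ n := by omega
  have hpos := hw.isRogersOrthoscheme.volume_pos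
  rw [hw.convexHull_eq_core hn] at hpos
  rw [hw.isRogersOrthoscheme.simplexDensity_eq hp, hw.convexHull_eq_core hn,
    SpherePacking.wedgeDensity, hw.wedge_eq hn]
  exact (hw.isWedgeConfig hn).density_lt hpos
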